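/- Let $n\ge 1$, let $\mathbb B^n$ be the open unit ball of $\mathbb C^n$, and let $\alpha,\beta>-1$. **Growth functions.** A growth function is a continuous non-decreasing map $\Phi$ from $[0,\infty)$ onto itself, and $\Phi^{-1}(t)=\inf\{s\ge 0:\Phi(s)\ge t\}$ (the usual inverse when $\Phi$ is injective). - For $q\ge 1$, $\mathscr U^q$ is the set of growth functions $\Phi$ such that $\Phi(t)/t$ is non-decreasing on $(0,\infty)$ and, for some $C>0$, $\Phi(st)\le Ct^q\Phi(s)$ for all $s>0$, $t\ge1$; $\mathscr U=\bigcup_{q\ge1}\mathscr U^q$. - For $0<p\le 1$, $\mathscr L_p$ is the set of growth functions $\Phi$ such that $\Phi(t)/t$ is non-increasing on $(0,\infty)$ and, for some $C>0$, $\Phi(st)\le Ct^p\Phi(s)$ for all $s>0$, $0<t\le1$; $\mathscr L=\bigcup_{0<p\le1}\mathscr L_p$. - $\tilde{\mathscr U}$ is the set of $\Phi$ for which there are $q\ge 1$ with $\Phi\in\mathscr U^q$ and constants $C_1,C_2>0$ with $\Phi(st)\le C_1\Phi(s)\Phi(t)$ for all $0<s\le1\le t$ and $\Phi(a/b)\le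 C_2\Phi(a)/b^q$ for all $a,b\ge1$. - $\tilde{\mathscr L}$ is the set of $\Phi$ for which there are $0<p\le 1$ with $\Phi\in\mathscr L_p$ and constants $C_1,C_3>0$ with $\Phi(st)\le C_1\Phi(s)\Phi(t)$ for all $0<s\le1\le t$ and $\Phi(a/b)\le C_3\,a^p/\Phi(b)$ for all $a,b\ge1$. **Spaces.** Let $d\nu_\alpha=c_\alpha(1-|z|^2)^\alpha d\nu$ be the weighted Lebesgue measure on $\mathbb B^n$, normalized to have mass $1$. $A^\Phi_\alpha(\mathbb B^n)$ is the space of holomorphic $f$ on $\mathbb B^n$ with $\int\Phi(|f|)\,d\nu_\alpha<\infty$, and $\|f\|^{lux}_{\Phi,\alpha}=\inf\{\lambda>0:\int\Phi(|f|/\lambda)\,d\nu_\alpha\le1\}$. A multiplier from $A^{\Phi_1}_\alpha$ to $A^{\Phi_2}_\beta$ is a holomorphic function $g$ on $\mathbb B^n$ for which there is $C>0$ such that, for every $f\in A^{\Phi_1}_\alpha$, $fg\in A^{\Phi_2}_\beta$ and $\|fg\|^{lux}_{\Phi_2,\beta}\le C\|f\|^{lux}_{\Phi_1,\alpha}$;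 $\mathcal M(A^{\Phi_1}_\alpha,A^{\Phi_2}_\beta)$ is the set of these. $H^\infty(\mathbb B^n)$ is the space of bounded holomorphic functions on $\mathbb B^n$, and for $\omega:(0,1]\to(0,\infty)$, $H^\infty_\omega(\mathbb B^n)$ is the space of holomorphic $f$ with $\sup_{z\in\mathbb B^n}|f(z)|/\omega(1-|z|)<\infty$. **Theorem.** Let $\Phi_1,\Phi_2\in\mathscr L\cup\mathscr U$ with $\Phi_2/\Phi_1$ non-decreasing on $(0,\infty)$, and put $$\gamma(t)=\frac{\Phi_2^{-1}(t^{n+1+\beta})}{\Phi_1^{-1}(t^{n+1+\alpha})},\qquad t\ge 1.$$ 1. If moreover $\Phi_2\in\tilde{\mathscr L}\cup\tilde{\mathscr U}$, and $\gamma$ is non-decreasing on $[1,\infty)$, then $\mathcal M(A^{\Phi_1}_\alpha,A^{\Phi_2}_\beta)=H^\infty_\omega(\mathbb B^n)$ with $\omega(s)=\gamma(1/s)$. 2. If $\gamma$ is equivalent to $1$, that is, $c\le\gamma(t)\le c^{-1}$ for some $c>0$ and all $t\ge 1$, then $\mathcal M(A^{\Phi_1}_\alpha,A^{\Phi_2}_\beta)=H^\infty(\mathbb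 B^n)$. 3. If $\gamma$ is non-increasing on $[1,\infty)$ and $\gamma(t)\to0$ as $t\to\infty$, then $\mathcal M(A^{\Phi_1}_\alpha,A^{\Phi_2}_\beta)=\{0\}$. -/

import Mathlib

open MeasureTheory Set Filter Topology
open scoped NNReal ENNReal

noncomputable section

namespace BergmanOrlicz

/-! ### Growth functions -/

/-- A growth function: a continuous non-decreasing function from `[0, ∞)` onto itself. -/
structure IsGrowth (Φ : ℝ≥0 → ℝ≥0) : Prop where
  continuous : Continuous Φ
  monotone : Monotone Φ
  surjective : Function.Surjective Φ

/-- `Φ` is of upper type `q`. -/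
def UpperType (q : ℝ) (Φ : ℝ≥0 → ℝ≥0) : Prop :=
  ∃ C : ℝ≥0, 0 < C ∧ ∀ s t : ℝ≥0, 0 < s → 1 ≤ t → Φ (s * t) ≤ C * t ^ q * Φ s

/-- `Φ` is of lower type `p`. -/
def LowerType (p : ℝ) (Φ : ℝ≥0 → ℝ≥0) : Prop :=
  ∃ C : ℝ≥0, 0 < C ∧ ∀ s t : ℝ≥0, 0 < s → 0 < t → t ≤ 1 → Φ (s * t) ≤ C * t ^ p * Φ s

/-- The class `𝓤^q`, for `q ≥ 1`. -/
structure IsUpper (q : ℝ) (Φ : ℝ≥0 → ℝ≥0) : Prop where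
  growth : IsGrowth Φ
  one_le : 1 ≤ q
  type : UpperType q Φ
  mono : MonotoneOn (fun t => Φ t / t) (Ioi 0)

/-- The class `𝓛_p`, for `0 < p ≤ 1`. -/
structure IsLower (p : ℝ) (Φ : ℝ≥0 → ℝ≥0) : Prop where
  growth : IsGrowth Φ
  pos : 0 < p
  le_one : p ≤ 1
  type : LowerType p Φ
  anti : AntitoneOn (fun t => Φ t / t) (Ioi 0)

/-- The class `𝓤`, the union of the `𝓤^q`. -/
def classU : Set (ℝ≥0 → ℝ≥0) := {Φ | ∃ q, IsUpper q Φ}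

/-- The class `𝓛`, the union of the `𝓛_p`. -/
def classL : Set (ℝ≥0 → ℝ≥0) := {Φ | ∃ p, IsLower p Φ}

/-- `Φ(st) ≤ C Φ(s) Φ(t)` for `0 < s ≤ 1 ≤ t`. -/
def SubmulCond (Φ : ℝ≥0 → ℝ≥0) : Prop :=
  ∃ C : ℝ≥0, 0 < C ∧ ∀ s t : ℝ≥0, 0 < s → s ≤ 1 → 1 ≤ t → Φ (s * t) ≤ C * Φ s * Φ t

/-- The class `𝓤̃`: the exponent in the last condition is that of `𝓤^q`. -/
def classUTilde : Set (ℝ≥0 → ℝ≥0) :=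
  {Φ | ∃ q, IsUpper q Φ ∧ SubmulCond Φ ∧
    ∃ C : ℝ≥0, 0 < C ∧ ∀ a b : ℝ≥0, 1 ≤ a → 1 ≤ b → Φ (a / b) ≤ C * (Φ a / b ^ q)}

/-- The class `𝓛̃`: the exponent in the last condition is that of `𝓛_p`. -/
def classLTilde : Set (ℝ≥0 → ℝ≥0) :=
  {Φ | ∃ p, IsLower p Φ ∧ SubmulCond Φ ∧
    ∃ C : ℝ≥0, 0 < C ∧ ∀ a b : ℝ≥0, 1 ≤ a → 1 ≤ b → Φ (a / b) ≤ C * (a ^ p / Φ b)}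

/-- The inverse `Φ⁻¹(t) = inf {s ≥ 0 : Φ(s) ≥ t}` of a growth function. It is a right inverse,
and it is the inverse function whenever `Φ` is injective. -/
def growthInv (Φ : ℝ≥0 → ℝ≥0) (t : ℝ≥0) : ℝ≥0 := sInf {s | t ≤ Φ s}

theorem IsGrowth.apply_growthInv {Φ : ℝ≥0 → ℝ≥0} (h : IsGrowth Φ) (t : ℝ≥0) :
    Φ (growthInv Φ t) = t := by
  obtain ⟨s, hs⟩ := h.surjective t
  have hmem : growthInv Φ t ∈ {s | t ≤ Φ s} :=
    (isClosed_Ici.preimage h.continuous : IsClosed {s | t ≤ Φ s}).csInf_mem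
      ⟨s, hs.ge⟩ (OrderBot.bddBelow _)
  refine le_antisymm ?_ hmem
  calc Φ (growthInv Φ t) ≤ Φ s := h.monotone (csInf_le (OrderBot.bddBelow _) hs.ge)
    _ = t := hs

theorem IsGrowth.growthInv_apply {Φ : ℝ≥0 → ℝ≥0} (h : IsGrowth Φ)
    (hinj : Function.Injective Φ) (s : ℝ≥0) : growthInv Φ (Φ s) = s :=
  hinj (h.apply_growthInv (Φ s))

/-! ### Function spaces on the unit ball of `ℂⁿ`

A function on the ball is represented by a function on `ℂⁿ`; only its values on the ball
matter. -/

/-- The open unit ball of `ℂⁿ`. -/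
abbrev unitBall (n : ℕ) : Set (EuclideanSpace ℂ (Fin n)) := Metric.ball 0 1

/-- The holomorphic functions on the ball. -/
def holo (n : ℕ) : Set (EuclideanSpace ℂ (Fin n) → ℂ) :=
  {f | DifferentiableOn ℂ f (unitBall n)}

/-- The measure `(1 - |z|²)^α dν(z)` on the ball, with `ν` the Lebesgue measure. -/
def preMeasure (n : ℕ) (α : ℝ) : Measure (EuclideanSpace ℂ (Fin n)) :=
  (volume.restrict (unitBall n)).withDensity fun z => ENNReal.ofReal ((1 - ‖z‖ ^ 2) ^ α)

/-- The normalized measure `dν_α = c_α (1 - |z|²)^α dν`. -/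
def nuMeasure (n : ℕ) (α : ℝ) : Measure (EuclideanSpace ℂ (Fin n)) :=
  (preMeasure n α univ)⁻¹ • preMeasure n α

/-- The weighted Bergman-Orlicz space `A_α^Φ`. -/
def bergmanOrlicz (n : ℕ) (α : ℝ) (Φ : ℝ≥0 → ℝ≥0) : Set (EuclideanSpace ℂ (Fin n) → ℂ) :=
  {f | f ∈ holo n ∧ ∫⁻ z, (Φ ‖f z‖₊ : ℝ≥0∞) ∂(nuMeasure n α) < ∞}

/-- The Luxemburg (quasi-)norm
`inf {l > 0 : ∫ Φ(|f| / l) dν_α ≤ 1}` (with value `∞` if there is no such `l`). -/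
def luxNorm (n : ℕ) (α : ℝ) (Φ : ℝ≥0 → ℝ≥0) (f : EuclideanSpace ℂ (Fin n) → ℂ) : ℝ≥0∞ :=
  ⨅ (l : ℝ≥0) (_ : 0 < l ∧ ∫⁻ z, (Φ (‖f z‖₊ / l) : ℝ≥0∞) ∂(nuMeasure n α) ≤ 1), (l : ℝ≥0∞)

/-- The multipliers from `A_α^{Φ₁}` to `A_β^{Φ₂}`. -/
def multipliers (n : ℕ) (α β : ℝ) (Φ₁ Φ₂ : ℝ≥0 → ℝ≥0) :
    Set (EuclideanSpace ℂ (Fin n) → ℂ) :=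
  {g | g ∈ holo n ∧ ∃ C : ℝ≥0, 0 < C ∧ ∀ f ∈ bergmanOrlicz n α Φ₁,
    (fun z => f z * g z) ∈ bergmanOrlicz n β Φ₂ ∧
      luxNorm n β Φ₂ (fun z => f z * g z) ≤ C * luxNorm n α Φ₁ f}

/-- The weighted space `H^∞_ω`, for a weight `ω` on `(0, 1]`. -/
def weightedHInf (n : ℕ) (ω : ℝ≥0 → ℝ≥0) : Set (EuclideanSpace ℂ (Fin n) → ℂ) :=
  {f | f ∈ holo n ∧ BddAbove ((fun z => ‖f z‖₊ / ω (1 - ‖z‖₊)) '' unitBall n)}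

/-- The space `H^∞` of bounded holomorphic functions. -/
def hInf (n : ℕ) : Set (EuclideanSpace ℂ (Fin n) → ℂ) :=
  {f | f ∈ holo n ∧ BddAbove ((fun z => ‖f z‖₊) '' unitBall n)}

/-- `γ(t) = Φ₂⁻¹(t^{n+1+β}) / Φ₁⁻¹(t^{n+1+α})`. -/
def gammaFun (n : ℕ) (α β : ℝ) (Φ₁ Φ₂ : ℝ≥0 → ℝ≥0) (t : ℝ≥0) : ℝ≥0 :=
  growthInv Φ₂ (t ^ ((n : ℝ) + 1 + β)) / growthInv Φ₁ (t ^ ((n : ℝ) + 1 + α))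

end BergmanOrlicz

end

/-! Fix z, put t = 1/(1-|z|), v = Φ₁⁻¹(t^(n+1+α)) and V = Φ₂⁻¹(t^(n+1+β)), so that γ(t) = V/v. Up to
constants, v is the largest value that |f(z)| takes on the unit ball of A_α^{Φ₁}, and V plays the
same role for A_β^{Φ₂}. The upper bound (`PowerBounds.exists_nnnorm_le`) is a sub-mean value
inequality on nonisotropic neighbourhoods of z. It is attained by multiples of powers of
(1-|a|)/(1-⟨a,z⟩) (`PowerBounds.exists_test_function`), whose integrals are controlled by the
measure of nonisotropic caps.

Necessity: testing a multiplier g on the extremal function at a gives |g(a)| v ≲ V, that is |g| ≲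
γ(1/(1-|z|)) (`exists_nnnorm_le_of_mem_multipliers`). When γ tends to 0, the maximum principle then
forces g = 0 on the ball.

Sufficiency (`mem_multipliers_of_transfer`): if f is normalized, then u = |f(z)|/M satisfies u ≤ v
for some constant M. It is enough that Φ₂(u V/v)/Φ₂(V) ≲ Φ₁(u)/Φ₁(v) for u ≤ v. Since Φ₁(v) and
Φ₂(V) are powers of t, this says Φ₂(uγ(t)) ≲ Φ₁(u) t^(β-α), and the factor t^(β-α) turns the weight
of exponent β into the one of exponent α under the integral. As Φ₂/Φ₁ is non-decreasing, Φ₁(u)/Φ₁(v)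
≥ Φ₂(u)/Φ₂(v), which leaves an inequality about Φ₂ alone. The tilde classes provide it
(`exists_transfer_of_classUTilde`, `exists_transfer_of_classLTilde`); when γ is equivalent to 1,
doubling suffices (`exists_transfer_of_bounded`).

Convexity is never used: all estimates on a single growth function rest on the two power bounds in
`PowerBounds`, which treats 𝓛 and 𝓤 together. -/

noncomputable section

namespace BergmanOrlicz

/-! ### Growth functions with power bounds -/

/-- A growth function of lower type `p ∈ (0, 1]` and upper type `q > 0`, with a common
constant. -/
structure PowerBounds (p q : ℝ) (C : ℝ≥0) (Φ : ℝ≥0 → ℝ≥0) : Prop where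
  growth : IsGrowth Φ
  lower_pos : 0 < p
  lower_le_one : p ≤ 1
  upper_pos : 0 < q
  const_pos : 0 < C
  lower : ∀ s t : ℝ≥0, t ≤ 1 → Φ (s * t) ≤ C * t ^ p * Φ s
  upper : ∀ s t : ℝ≥0, 1 ≤ t → Φ (s * t) ≤ C * t ^ q * Φ s

theorem IsGrowth.map_zero {Φ : ℝ≥0 → ℝ≥0} (h : IsGrowth Φ) : Φ 0 = 0 := by
  obtain ⟨s, hs⟩ := h.surjective 0
  exact le_antisymm ((h.monotone zero_le).trans hs.le) zero_le

theorem PowerBounds.of_pos {p q : ℝ} {Φ : ℝ≥0 → ℝ≥0} (h : IsGrowth Φ) (hp : 0 < p) (hp1 : p ≤ 1)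
    (hq : 0 < q) {A B : ℝ≥0} (hA : 0 < A)
    (hl : ∀ s t : ℝ≥0, 0 < s → 0 < t → t ≤ 1 → Φ (s * t) ≤ A * t ^ p * Φ s)
    (hu : ∀ s t : ℝ≥0, 0 < s → 1 ≤ t → Φ (s * t) ≤ B * t ^ q * Φ s) :
    PowerBounds p q (max A B) Φ := by
  refine ⟨h, hp, hp1, hq, lt_max_of_lt_left hA, fun s t ht => ?_, fun s t ht => ?_⟩
  · rcases eq_or_ne s 0 with rfl | hs
    · simp [h.map_zero]
    rcases eq_or_ne t 0 with rfl | ht0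
    · simp [h.map_zero]
    refine (hl s t (pos_iff_ne_zero.2 hs) (pos_iff_ne_zero.2 ht0) ht).trans ?_
    gcongr
    exact le_max_left _ _
  · rcases eq_or_ne s 0 with rfl | hs
    · simp [h.map_zero]
    refine (hu s t (pos_iff_ne_zero.2 hs) ht).trans ?_
    gcongr
    exact le_max_right _ _

/-- Monotonicity of Φ(t)/t is exactly lower type 1 with constant 1. For 𝓛 the roles are exchanged:
there it gives upper type 1. -/
theorem IsUpper.exists_powerBounds {q : ℝ} {Φ : ℝ≥0 → ℝ≥0} (h : IsUpper q Φ) :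
    ∃ C, PowerBounds 1 q C Φ := by
  obtain ⟨B, -, hB⟩ := h.type
  refine ⟨_, PowerBounds.of_pos h.growth one_pos le_rfl (one_pos.trans_le h.one_le) one_pos
    (fun s t hs ht ht1 => ?_) hB⟩
  have hst : 0 < s * t := mul_pos hs ht
  have := h.mono (mem_Ioi.2 hst) (mem_Ioi.2 hs) (mul_le_of_le_one_right' ht1)
  simp only [div_le_iff₀ hst] at this
  calc Φ (s * t) ≤ Φ s / s * (s * t) := this
    _ = 1 * t ^ (1 : ℝ) * Φ s := by
      rw [NNReal.rpow_one]; field_simp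

theorem IsLower.exists_powerBounds {p : ℝ} {Φ : ℝ≥0 → ℝ≥0} (h : IsLower p Φ) :
    ∃ C, PowerBounds p 1 C Φ := by
  obtain ⟨A, hA0, hA⟩ := h.type
  refine ⟨_, PowerBounds.of_pos (B := 1) h.growth h.pos h.le_one one_pos hA0 hA
    (fun s t hs ht1 => ?_)⟩
  have ht : 0 < t := one_pos.trans_le ht1
  have hst : 0 < s * t := mul_pos hs ht
  have := h.anti (mem_Ioi.2 hs) (mem_Ioi.2 hst) (le_mul_of_one_le_right' ht1)
  simp only [div_le_iff₀ hst] at this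
  calc Φ (s * t) ≤ Φ s / s * (s * t) := this
    _ = 1 * t ^ (1 : ℝ) * Φ s := by
      rw [NNReal.rpow_one]; field_simp

theorem exists_powerBounds {Φ : ℝ≥0 → ℝ≥0} (h : Φ ∈ classL ∪ classU) :
    ∃ p q C, PowerBounds p q C Φ := by
  rcases h with ⟨p, h⟩ | ⟨q, h⟩
  · exact ⟨p, 1, h.exists_powerBounds⟩
  · exact ⟨1, q, h.exists_powerBounds⟩

namespace PowerBounds

variable {p q : ℝ} {C : ℝ≥0} {Φ : ℝ≥0 → ℝ≥0}

/-- A growth function is at most multiplied by a constant when its argument is. -/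
theorem exists_map_mul_le (h : PowerBounds p q C Φ) (K : ℝ≥0) :
    ∃ A : ℝ≥0, 0 < A ∧ ∀ x, Φ (K * x) ≤ A * Φ x := by
  refine ⟨C * max 1 K ^ q, mul_pos h.const_pos
    (NNReal.rpow_pos (lt_max_of_lt_left one_pos)), fun x => ?_⟩
  calc Φ (K * x) ≤ Φ (x * max 1 K) := h.growth.monotone (by
        rw [mul_comm]; gcongr; exact le_max_right _ _)
    _ ≤ _ := h.upper _ _ (le_max_left _ _)

/-- By doubling, a zero at one positive point would propagate to every point, against surjectivity.
-/
theorem map_pos (h : PowerBounds p q C Φ) {x : ℝ≥0} (hx : 0 < x) : 0 < Φ x := by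
  obtain ⟨y, hy⟩ := h.growth.surjective 1
  obtain ⟨A, -, hA⟩ := h.exists_map_mul_le (y / x)
  have := hA x
  rw [div_mul_cancel₀ _ hx.ne', hy] at this
  by_contra h0
  simp [le_zero_iff.1 (not_lt.1 h0)] at this

theorem growthInv_pos (h : PowerBounds p q C Φ) {t : ℝ≥0} (ht : 0 < t) : 0 < growthInv Φ t := by
  refine pos_iff_ne_zero.2 fun h0 => ht.ne ?_
  rw [← h.growth.apply_growthInv t, h0, h.growth.map_zero]

/-- Lower type lets any constant in front of Φ be absorbed by shrinking the argument; K is chosen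
with K^p ≥ AC. This replaces convexity when modular bounds are turned into Luxemburg bounds. -/
theorem exists_mul_map_le (h : PowerBounds p q C Φ) (A : ℝ≥0) :
    ∃ K : ℝ≥0, 1 ≤ K ∧ ∀ x, A * Φ (x / K) ≤ Φ x := by
  refine ⟨max 1 ((A * C) ^ p⁻¹), le_max_left _ _, fun x => ?_⟩
  set K := max 1 ((A * C) ^ p⁻¹) with hK
  have hK1 : 1 ≤ K := le_max_left _ _
  have hK0 : 0 < K := one_pos.trans_le hK1
  have h1 : A * C ≤ K ^ p := by
    calc A * C = ((A * C) ^ p⁻¹) ^ p := (NNReal.rpow_inv_rpow h.lower_pos.ne' _).symm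
      _ ≤ K ^ p := NNReal.rpow_le_rpow (le_max_right _ _) h.lower_pos.le
  calc A * Φ (x / K) ≤ A * (C * (K⁻¹) ^ p * Φ x) := by
        rw [div_eq_mul_inv]; gcongr
        exact h.lower _ _ (inv_le_one_of_one_le₀ hK1)
    _ = (A * C) * (K ^ p)⁻¹ * Φ x := by rw [NNReal.inv_rpow]; ring
    _ ≤ K ^ p * (K ^ p)⁻¹ * Φ x := by gcongr
    _ = Φ x := by rw [mul_inv_cancel₀ (NNReal.rpow_pos hK0).ne', one_mul]

theorem exists_le_mul_growthInv (h : PowerBounds p q C Φ) (A : ℝ≥0) :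
    ∃ K : ℝ≥0, 0 < K ∧ ∀ x Y : ℝ≥0, 0 < Y → Φ x ≤ A * Y → x ≤ K * growthInv Φ Y := by
  -- Using A + 1 instead of A makes the final contradiction (A + 1)Y ≤ AY strict.
  obtain ⟨K, hK1, hK⟩ := h.exists_mul_map_le (A + 1)
  have hK0 : 0 < K := one_pos.trans_le hK1
  refine ⟨K, hK0, fun x Y hY hx => ?_⟩
  by_contra! hlt
  have h1 : growthInv Φ Y ≤ x / K := by rw [le_div_iff₀ hK0, mul_comm]; exact hlt.le
  have h2 := h.growth.monotone h1
  rw [h.growth.apply_growthInv] at h2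
  have h3 : (A + 1) * Y ≤ A * Y := by
    calc (A + 1) * Y ≤ (A + 1) * Φ (x / K) := by gcongr
      _ ≤ Φ x := hK x
      _ ≤ _ := hx
  rw [add_mul, one_mul] at h3
  exact hY.ne' (le_zero_iff.1 (by simpa using h3))

/-- This carries a sub-mean value inequality from |f|^p to Φ(|f|). If y/x is below η^(1/p), the term
η suffices; if y ≥ x, use the lower type; in between, the upper type with the fixed factor η^(-1/p).
-/
theorem exists_rpow_div_le (h : PowerBounds p q C Φ) {η : ℝ≥0} (hη : 0 < η) (hη1 : η ≤ 1) :
    ∃ A : ℝ≥0, ∀ x y : ℝ≥0, 0 < x → (y / x) ^ p ≤ η + A * (Φ y / Φ x) := by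
  set ε : ℝ≥0 := η ^ p⁻¹ with hε
  have hε0 : 0 < ε := NNReal.rpow_pos hη
  have hε1 : ε ≤ 1 := NNReal.rpow_le_one hη1 (inv_nonneg.2 h.lower_pos.le)
  have hinv : 1 ≤ ε⁻¹ := (one_le_inv₀ hε0).2 hε1
  refine ⟨C * ε⁻¹ ^ q, fun x y hx => ?_⟩
  have hΦx := h.map_pos hx
  rcases le_total y (ε * x) with hy | hy
  · refine le_add_of_le_of_nonneg ?_ zero_le
    calc (y / x) ^ p ≤ ε ^ p := NNReal.rpow_le_rpow ((div_le_iff₀ hx).2 hy) h.lower_pos.le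
      _ = η := NNReal.rpow_inv_rpow h.lower_pos.ne' _
  refine le_add_of_nonneg_of_le zero_le ?_
  have hy0 : 0 < y := (mul_pos hε0 hx).trans_le hy
  rw [← mul_div_assoc, le_div_iff₀ hΦx]
  rcases le_total x y with hxy | hxy
  · have h1 := h.lower y (x / y) ((div_le_one hy0).2 hxy)
    rw [mul_div_cancel₀ _ hy0.ne'] at h1
    calc (y / x) ^ p * Φ x ≤ (y / x) ^ p * (C * (x / y) ^ p * Φ y) := by gcongr
      _ = C * ((y / x) ^ p * (x / y) ^ p) * Φ y := by ring
      _ = C * 1 * Φ y := by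
        rw [← NNReal.mul_rpow, div_mul_div_cancel₀ hx.ne', div_self hy0.ne', NNReal.one_rpow]
      _ ≤ C * ε⁻¹ ^ q * Φ y := by
        gcongr
        exact NNReal.one_le_rpow hinv h.upper_pos.le
  · have h1 : (y / x) ^ p ≤ 1 := NNReal.rpow_le_one ((div_le_one hx).2 hxy) h.lower_pos.le
    calc (y / x) ^ p * Φ x ≤ 1 * Φ (y * ε⁻¹) := by
          gcongr
          refine h.growth.monotone ?_
          rw [← div_eq_mul_inv, le_div_iff₀ hε0, mul_comm]; exact hy
      _ ≤ C * ε⁻¹ ^ q * Φ y := by rw [one_mul]; exact h.upper _ _ hinv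

theorem rpow_div_le (h : PowerBounds p q C Φ) {c x : ℝ≥0} (hc : 0 < c) (hx : c ≤ x) :
    (x / c) ^ p ≤ C * (Φ x / Φ c) := by
  have hx0 := hc.trans_le hx
  have h1 := h.lower x (c / x) ((div_le_one hx0).2 hx)
  rw [mul_div_cancel₀ _ hx0.ne'] at h1
  rw [← mul_div_assoc, le_div_iff₀ (h.map_pos hc)]
  calc (x / c) ^ p * Φ c ≤ (x / c) ^ p * (C * (c / x) ^ p * Φ x) := by gcongr
      _ = C * ((x / c) ^ p * (c / x) ^ p) * Φ x := by ring
      _ = C * Φ x := by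
        rw [← NNReal.mul_rpow, div_mul_div_cancel₀ hc.ne', div_self hx0.ne', NNReal.one_rpow,
          mul_one]

end PowerBounds

/-! ### Comparison of two growth functions -/

section Comparison

variable {Φ₁ Φ₂ : ℝ≥0 → ℝ≥0} {p₁ q₁ : ℝ} {C₁ : ℝ≥0}

theorem PowerBounds.cross_le (h₁ : PowerBounds p₁ q₁ C₁ Φ₁)
    (hmono : MonotoneOn (fun t => Φ₂ t / Φ₁ t) (Ioi 0)) {u v : ℝ≥0} (hu : 0 < u) (huv : u ≤ v) :
    Φ₂ u * Φ₁ v ≤ Φ₂ v * Φ₁ u := by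
  have hv := hu.trans_le huv
  have := hmono (mem_Ioi.2 hu) (mem_Ioi.2 hv) huv
  rwa [div_le_div_iff₀ (h₁.map_pos hu) (h₁.map_pos hv)] at this

/-- When v and V are comparable, doubling of Φ₂ replaces uV/v by u and v by V, and the inequality
becomes the monotonicity of Φ₂/Φ₁. -/
theorem exists_transfer_of_bounded {p₂ q₂ : ℝ} {C₂ : ℝ≥0} (h₁ : PowerBounds p₁ q₁ C₁ Φ₁)
    (h₂ : PowerBounds p₂ q₂ C₂ Φ₂)
    (hmono : MonotoneOn (fun t => Φ₂ t / Φ₁ t) (Ioi 0)) (K : ℝ≥0) :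
    ∃ A : ℝ≥0, ∀ u v V : ℝ≥0, 0 < V → u ≤ v → V / v ≤ K → v / V ≤ K →
      Φ₂ (u * (V / v)) * Φ₁ v ≤ A * Φ₁ u * Φ₂ V := by
  obtain ⟨A, -, hA⟩ := h₂.exists_map_mul_le K
  refine ⟨A * A, fun u v V hV huv h1 h2 => ?_⟩
  rcases eq_or_ne u 0 with rfl | hu
  · simp [h₂.growth.map_zero]
  calc Φ₂ (u * (V / v)) * Φ₁ v ≤ Φ₂ (K * u) * Φ₁ v := by
        gcongr
        refine h₂.growth.monotone ?_
        rw [mul_comm]; gcongr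
    _ ≤ A * (Φ₂ u * Φ₁ v) := by rw [← mul_assoc]; gcongr; exact hA u
    _ ≤ A * (Φ₂ v * Φ₁ u) :=
        mul_le_mul_right (h₁.cross_le hmono (pos_iff_ne_zero.2 hu) huv) _
    _ ≤ A * (Φ₂ (K * V) * Φ₁ u) := by
        gcongr
        refine h₂.growth.monotone ?_
        rwa [div_le_iff₀ hV] at h2
    _ ≤ A * ((A * Φ₂ V) * Φ₁ u) := by gcongr; exact hA V
    _ = _ := by ring

/-- With b = v/u, the class gives Φ₂(V/b) ≲ Φ₂(V)/b^q, while Φ₁(v)/Φ₁(u) ≤ Φ₂(v)/Φ₂(u) ≲ b^q by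
upper type. The same exponent q occurs in both, so the powers cancel. -/
theorem exists_transfer_of_classUTilde (h₁ : PowerBounds p₁ q₁ C₁ Φ₁) (h₂ : Φ₂ ∈ classUTilde)
    (hmono : MonotoneOn (fun t => Φ₂ t / Φ₁ t) (Ioi 0)) {c : ℝ≥0} (hc : 0 < c) (hc1 : c ≤ 1) :
    ∃ A : ℝ≥0, ∀ u v V : ℝ≥0, c ≤ V → u ≤ v →
      Φ₂ (u * (V / v)) * Φ₁ v ≤ A * Φ₁ u * Φ₂ V := by
  obtain ⟨q, hq, -, D, -, hD⟩ := h₂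
  obtain ⟨C, hb⟩ := hq.exists_powerBounds
  -- The class condition needs an argument at least 1, whereas only V ≥ c is known; V is therefore
  -- replaced by V/c at the cost of A.
  obtain ⟨A, -, hA⟩ := hb.exists_map_mul_le c⁻¹
  refine ⟨D * A * C, fun u v V hV huv => ?_⟩
  rcases eq_or_ne u 0 with rfl | hu
  · simp [hb.growth.map_zero]
  replace hu := pos_iff_ne_zero.2 hu
  have hv := hu.trans_le huv
  set b := v / u with hb'
  have hb1 : 1 ≤ b := (one_le_div hu).2 huv
  have hbq : 0 < b ^ q := NNReal.rpow_pos (one_pos.trans_le hb1)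
  have key1 : Φ₂ (u * (V / v)) ≤ D * (A * Φ₂ V / b ^ q) := by
    calc Φ₂ (u * (V / v)) ≤ Φ₂ (c⁻¹ * V / b) := by
          refine hb.growth.monotone ?_
          calc u * (V / v) = 1 * V / b := by rw [hb']; field_simp
            _ ≤ _ := by gcongr; exact (one_le_inv₀ hc).2 hc1
      _ ≤ D * (Φ₂ (c⁻¹ * V) / b ^ q) := by
          refine hD _ _ ?_ hb1
          rw [inv_mul_eq_div]; exact (one_le_div hc).2 hV
      _ ≤ _ := by gcongr; exact hA V
  have key2 : Φ₁ v ≤ C * b ^ q * Φ₁ u := by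
    have h3 := h₁.cross_le hmono hu huv
    have h4 := hb.upper u b hb1
    rw [hb', mul_div_cancel₀ _ hu.ne', ← hb'] at h4
    refine le_of_mul_le_mul_left ?_ (hb.map_pos hu)
    calc Φ₂ u * Φ₁ v ≤ Φ₂ v * Φ₁ u := h3
      _ ≤ C * b ^ q * Φ₂ u * Φ₁ u := by gcongr
      _ = _ := by ring
  calc Φ₂ (u * (V / v)) * Φ₁ v ≤ D * (A * Φ₂ V / b ^ q) * (C * b ^ q * Φ₁ u) := by gcongr
    _ = _ := by field_simp

/-- The argument is that for 𝓤̃ with Φ₂(b) in place of b^q. The class gives Φ₂(V/b) ≲ V^p/Φ₂(b) ≲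
Φ₂(V)/Φ₂(b), and submultiplicativity gives Φ₂(v)/Φ₂(u) ≲ Φ₂(b). -/
theorem exists_transfer_of_classLTilde (h₁ : PowerBounds p₁ q₁ C₁ Φ₁) (h₂ : Φ₂ ∈ classLTilde)
    (hmono : MonotoneOn (fun t => Φ₂ t / Φ₁ t) (Ioi 0)) {c : ℝ≥0} (hc : 0 < c) (hc1 : c ≤ 1) :
    ∃ A : ℝ≥0, ∀ u v V : ℝ≥0, c ≤ V → u ≤ v →
      Φ₂ (u * (V / v)) * Φ₁ v ≤ A * Φ₁ u * Φ₂ V := by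
  obtain ⟨p, hp, ⟨B, -, hB⟩, D, -, hD⟩ := h₂
  obtain ⟨C, hb⟩ := hp.exists_powerBounds
  have hΦc := hb.map_pos hc
  have hΦ1 := hb.map_pos one_pos
  -- Submultiplicativity is assumed only for u ≤ 1. For u ≥ 1, the class condition with denominator
  -- 1 bounds Φ₂(x) by a multiple of x^p, and lower type gives the converse bound, so Φ₂ behaves
  -- like x^p on [1, ∞).
  have hmul : ∃ M : ℝ≥0, ∀ u b : ℝ≥0, 0 < u → 1 ≤ b → Φ₂ (u * b) ≤ M * Φ₂ u * Φ₂ b := by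
    refine ⟨max B (D * C * C / (Φ₂ 1 * Φ₂ 1 * Φ₂ 1)), fun u b hu hb1 => ?_⟩
    rcases le_total u 1 with hu1 | hu1
    · refine (hB u b hu hu1 hb1).trans ?_
      gcongr
      exact le_max_left _ _
    · have h1 := hb.rpow_div_le one_pos hu1
      have h2 := hb.rpow_div_le one_pos hb1
      have h3 := hD (u * b) 1 (one_le_mul hu1 hb1) le_rfl
      rw [div_one] at h1 h2 h3
      calc Φ₂ (u * b) ≤ D * ((u * b) ^ p / Φ₂ 1) := h3
        _ = D * (u ^ p * b ^ p / Φ₂ 1) := by rw [NNReal.mul_rpow]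
        _ ≤ D * ((C * (Φ₂ u / Φ₂ 1)) * (C * (Φ₂ b / Φ₂ 1)) / Φ₂ 1) := by gcongr
        _ = (D * C * C / (Φ₂ 1 * Φ₂ 1 * Φ₂ 1)) * Φ₂ u * Φ₂ b := by field_simp
        _ ≤ _ := by gcongr; exact le_max_right _ _
  obtain ⟨M, hM⟩ := hmul
  refine ⟨D * C * M / Φ₂ c, fun u v V hV huv => ?_⟩
  rcases eq_or_ne u 0 with rfl | hu
  · simp [hb.growth.map_zero]
  replace hu := pos_iff_ne_zero.2 hu
  have hv := hu.trans_le huv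
  set b := v / u with hb'
  have hb1 : 1 ≤ b := (one_le_div hu).2 huv
  have hΦb := hb.map_pos (one_pos.trans_le hb1)
  have key1 : Φ₂ (u * (V / v)) ≤ D * (C * (Φ₂ V / Φ₂ c) / Φ₂ b) := by
    calc Φ₂ (u * (V / v)) ≤ Φ₂ (V / c / b) := by
          refine hb.growth.monotone ?_
          calc u * (V / v) = V / 1 / b := by rw [hb']; field_simp
            _ ≤ _ := by gcongr
      _ ≤ D * ((V / c) ^ p / Φ₂ b) := hD _ _ ((one_le_div hc).2 hV) hb1
      _ ≤ _ := by gcongr; exact hb.rpow_div_le hc hV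
  have key2 : Φ₁ v ≤ M * Φ₂ b * Φ₁ u := by
    have h3 := h₁.cross_le hmono hu huv
    have h4 := hM u b hu hb1
    rw [hb', mul_div_cancel₀ _ hu.ne', ← hb'] at h4
    refine le_of_mul_le_mul_left ?_ (hb.map_pos hu)
    calc Φ₂ u * Φ₁ v ≤ Φ₂ v * Φ₁ u := h3
      _ ≤ M * Φ₂ u * Φ₂ b * Φ₁ u := by gcongr
      _ = _ := by ring
  calc Φ₂ (u * (V / v)) * Φ₁ v
      ≤ D * (C * (Φ₂ V / Φ₂ c) / Φ₂ b) * (M * Φ₂ b * Φ₁ u) := by gcongr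
    _ = _ := by field_simp

end Comparison

/-! ### Sub-mean value inequalities -/

/-- Multiplication by a complex number of modulus one, as a real linear isometry. -/
def rotation (n : ℕ) (u : ℂ) (hu : ‖u‖ = 1) :
    EuclideanSpace ℂ (Fin n) ≃ₗᵢ[ℝ] EuclideanSpace ℂ (Fin n) where
  toLinearEquiv := (LinearEquiv.smulOfNeZero ℂ (EuclideanSpace ℂ (Fin n)) u
    (by rintro rfl; simp at hu)).restrictScalars ℝ
  norm_map' x := by simp [norm_smul, hu]

theorem rotation_apply {n : ℕ} {u : ℂ} (hu : ‖u‖ = 1) (x : EuclideanSpace ℂ (Fin n)) :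
    rotation n u hu x = u • x := rfl

theorem lintegral_comp_rotation {n : ℕ} {u : ℂ} (hu : ‖u‖ = 1)
    {F : EuclideanSpace ℂ (Fin n) → ℝ≥0∞} (hF : Measurable F) (c : EuclideanSpace ℂ (Fin n)) :
    ∫⁻ z, F (c + u • z) = ∫⁻ z, F z := by
  have := (rotation n u hu).measurePreserving.lintegral_comp
    (hF.comp (measurable_const_add c))
  simp only [Function.comp_apply, rotation_apply] at this
  rw [this]
  exact lintegral_add_left_eq_self F c

/-- The mean value property of the one-variable function ζ ↦ f(c + ζz) on the unit circle. -/
theorem enorm_le_lintegral_circle {n : ℕ} {f : EuclideanSpace ℂ (Fin n) → ℂ}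
    {c z : EuclideanSpace ℂ (Fin n)} {ρ : ℝ} (hf : DifferentiableOn ℂ f (Metric.ball c ρ))
    (hz : ‖z‖ < ρ) :
    ENNReal.ofReal (2 * Real.pi) * ‖f c‖ₑ ≤
      ∫⁻ θ in Ioc 0 (2 * Real.pi), ‖f (c + circleMap 0 1 θ • z)‖ₑ := by
  have hd : DifferentiableOn ℂ (fun ζ : ℂ => f (c + ζ • z)) (Metric.closedBall 0 1) := by
    refine hf.comp (by fun_prop) fun ζ hζ => ?_
    rw [mem_closedBall_zero_iff] at hζ
    rw [Metric.mem_ball, dist_self_add_left, norm_smul]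
    exact (mul_le_of_le_one_left (norm_nonneg z) hζ).trans_lt hz
  have hcl : DiffContOnCl ℂ (fun ζ : ℂ => f (c + ζ • z)) (Metric.ball 0 |1|) := by
    rw [abs_one]
    exact hd.diffContOnCl_ball subset_rfl
  have := hcl.circleAverage
  rw [Real.circleAverage_def, inv_smul_eq_iff₀ Real.two_pi_pos.ne', zero_smul, add_zero,
    intervalIntegral.integral_of_le Real.two_pi_pos.le] at this
  have h2 : ENNReal.ofReal (2 * Real.pi) * ‖f c‖ₑ = ‖(2 * Real.pi) • f c‖ₑ := by
    rw [enorm_smul, Real.enorm_of_nonneg Real.two_pi_pos.le]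
  rw [h2, ← this]
  exact enorm_integral_le_lintegral_enorm _

/-- The modulus of a holomorphic function at the centre of a ball is at most its mean. -/
theorem enorm_mul_volume_ball_le {n : ℕ} {f : EuclideanSpace ℂ (Fin n) → ℂ}
    {c : EuclideanSpace ℂ (Fin n)} {ρ : ℝ} (hf : DifferentiableOn ℂ f (Metric.ball c ρ)) :
    ‖f c‖ₑ * volume (Metric.ball c ρ) ≤ ∫⁻ z in Metric.ball c ρ, ‖f z‖ₑ := by
  classical
  -- Since f is arbitrary off the ball, it is cut off there to obtain a globally measurable
  -- integrand for Tonelli.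
  set F : EuclideanSpace ℂ (Fin n) → ℝ≥0∞ :=
    (Metric.ball c ρ).piecewise (fun z => ‖f z‖ₑ) 0 with hF
  have hFm : Measurable F :=
    ContinuousOn.measurable_piecewise hf.continuousOn.enorm continuousOn_const
      Metric.isOpen_ball.measurableSet
  have hFi : ∫⁻ z in Metric.ball c ρ, ‖f z‖ₑ = ∫⁻ z, F z := by
    rw [← lintegral_indicator Metric.isOpen_ball.measurableSet]
    simp [hF, Set.piecewise_eq_indicator]
  have hpi : ENNReal.ofReal (2 * Real.pi) ≠ 0 := by
    simpa using Real.pi_pos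
  have key : ∀ z ∈ Metric.ball (0 : EuclideanSpace ℂ (Fin n)) ρ,
      ENNReal.ofReal (2 * Real.pi) * ‖f c‖ₑ ≤
        ∫⁻ θ in Ioc 0 (2 * Real.pi), F (c + circleMap 0 1 θ • z) := by
    intro z hz
    rw [mem_ball_zero_iff] at hz
    refine (enorm_le_lintegral_circle hf hz).trans (le_of_eq (lintegral_congr fun θ => ?_))
    rw [hF, Set.piecewise_eq_of_mem]
    rw [Metric.mem_ball, dist_self_add_left, norm_smul, norm_circleMap_zero]
    simpa using hz
  have hvol : volume (Metric.ball c ρ) = volume (Metric.ball (0 : EuclideanSpace ℂ (Fin n)) ρ) :=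
    Measure.addHaar_ball_center _ _ _
  have hunc : Measurable (Function.uncurry fun (z : EuclideanSpace ℂ (Fin n)) (θ : ℝ) =>
      F (c + circleMap 0 1 θ • z)) := by
    refine hFm.comp (Continuous.measurable ?_)
    have := continuous_circleMap 0 1
    fun_prop
  rw [hFi, hvol, ← ENNReal.mul_le_mul_iff_right hpi ENNReal.ofReal_ne_top]
  calc ENNReal.ofReal (2 * Real.pi) * (‖f c‖ₑ * volume (Metric.ball (0 : EuclideanSpace ℂ (Fin n)) ρ))
      = ∫⁻ z in Metric.ball (0 : EuclideanSpace ℂ (Fin n)) ρ,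
          ENNReal.ofReal (2 * Real.pi) * ‖f c‖ₑ := by
        rw [setLIntegral_const, mul_assoc]
    _ ≤ ∫⁻ z in Metric.ball (0 : EuclideanSpace ℂ (Fin n)) ρ,
          ∫⁻ θ in Ioc 0 (2 * Real.pi), F (c + circleMap 0 1 θ • z) :=
        setLIntegral_mono' Metric.isOpen_ball.measurableSet key
    _ ≤ ∫⁻ z : EuclideanSpace ℂ (Fin n),
          ∫⁻ θ in Ioc 0 (2 * Real.pi), F (c + circleMap 0 1 θ • z) :=
        setLIntegral_le_lintegral _ _
    _ = ∫⁻ θ in Ioc 0 (2 * Real.pi), ∫⁻ z, F (c + circleMap 0 1 θ • z) :=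
        lintegral_lintegral_swap hunc.aemeasurable
    _ = ∫⁻ θ in Ioc 0 (2 * Real.pi), ∫⁻ z, F z :=
        lintegral_congr fun θ => lintegral_comp_rotation (by simp) hFm c
    _ = ENNReal.ofReal (2 * Real.pi) * ∫⁻ z, F z := by
        rw [setLIntegral_const, Real.volume_Ioc, sub_zero, mul_comm]

theorem finrank_real_euclidean (n : ℕ) :
    Module.finrank ℝ (EuclideanSpace ℂ (Fin n)) = 2 * n := by
  rw [← Module.finrank_mul_finrank ℝ ℂ]; simp

theorem volume_ball_eq {n : ℕ} (c : EuclideanSpace ℂ (Fin n)) {ρ : ℝ} (hρ : 0 < ρ) :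
    volume (Metric.ball c ρ) = ENNReal.ofReal (ρ ^ (2 * n)) * volume (unitBall n) := by
  rw [Measure.addHaar_ball_of_pos _ _ hρ, finrank_real_euclidean]

/-- A weak form of the subharmonicity of `|f| ^ p` for holomorphic `f`. -/
theorem exists_le_lintegral_rpow {n : ℕ} (hn : 1 ≤ n) {p : ℝ} (hp : 0 < p) (hp1 : p ≤ 1) :
    ∃ θ : ℝ≥0, 0 < θ ∧ θ ≤ 1 ∧ ∀ f : EuclideanSpace ℂ (Fin n) → ℂ,
      ContinuousOn f (Metric.closedBall 0 1) → DifferentiableOn ℂ f (unitBall n) → ‖f 0‖ = 1 →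
        θ * volume (unitBall n) ≤ ∫⁻ z in unitBall n, ((‖f z‖₊ ^ p : ℝ≥0) : ℝ≥0∞) := by
  -- This exponent makes ρ^(2n) = (ρ^K)^p, so that the volume of the small ball matches the powers
  -- of its radius below.
  set K : ℝ := 2 * n / p with hK
  have hn0 : (0 : ℝ) < n := by exact_mod_cast hn
  have hK0 : 0 < K := by positivity
  refine ⟨(1 / 2) ^ K, by positivity, NNReal.rpow_le_one (by norm_num) hK0.le,
    fun f hc hd h0 => ?_⟩
  -- Maximizing the weighted modulus bounds |f| near z₀ by a multiple of |f(z₀)|. There |f| =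
  -- |f|^(1-p)|f|^p ≤ M|f|^p, and the mean value inequality for |f| at z₀ yields one for |f|^p.
  obtain ⟨z₀, hz₀, hmax⟩ := (isCompact_closedBall (0 : EuclideanSpace ℂ (Fin n)) 1).exists_isMaxOn
    ⟨0, by simp⟩ (f := fun z => (1 - ‖z‖) ^ K * ‖f z‖)
    (((continuous_const.sub continuous_norm).continuousOn.rpow_const fun _ _ => Or.inr hK0.le).mul
      hc.norm)
  set S : ℝ := (1 - ‖z₀‖) ^ K * ‖f z₀‖ with hS
  have hS1 : 1 ≤ S := by
    have := hmax (Metric.mem_closedBall_self zero_le_one)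
    simpa [h0] using this
  have hS0 : 0 < S := one_pos.trans_le hS1
  have hz₀1 : ‖z₀‖ < 1 := by
    refine lt_of_le_of_ne (mem_closedBall_zero_iff.1 hz₀) fun h1 => ?_
    rw [hS, h1, sub_self, Real.zero_rpow hK0.ne', zero_mul] at hS0
    exact hS0.false
  set ρ : ℝ := (1 - ‖z₀‖) / 2 with hρ
  have hρ0 : 0 < ρ := by rw [hρ]; linarith
  have hsub : ∀ z ∈ Metric.ball z₀ ρ, ρ ≤ 1 - ‖z‖ := fun z hz => by
    have h1 := norm_le_norm_add_norm_sub' z z₀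
    rw [mem_ball_iff_norm] at hz
    linarith
  have hsub' : Metric.ball z₀ ρ ⊆ unitBall n := fun z hz => by
    rw [mem_ball_zero_iff]; linarith [hsub z hz]
  set R : ℝ := ρ ^ K with hR
  have hR0 : 0 < R := Real.rpow_pos_of_pos hρ0 _
  set M : ℝ := (S / R) ^ (1 - p) with hM
  have hM0 : 0 < M := Real.rpow_pos_of_pos (div_pos hS0 hR0) _
  have hle : ∀ z ∈ Metric.ball z₀ ρ, ‖f z‖ ≤ M * ‖f z‖ ^ p := fun z hz => by
    rcases eq_or_ne (f z) 0 with hz0 | hz0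
    · rw [hz0, norm_zero]; positivity
    have hfz : 0 < ‖f z‖ := norm_pos_iff.2 hz0
    have h1 : ‖f z‖ ≤ S / R := by
      rw [le_div_iff₀ hR0, mul_comm]
      calc R * ‖f z‖ ≤ (1 - ‖z‖) ^ K * ‖f z‖ := by
            gcongr; exact Real.rpow_le_rpow hρ0.le (hsub z hz) hK0.le
        _ ≤ S := hmax (Metric.ball_subset_closedBall (hsub' hz))
    calc ‖f z‖ = ‖f z‖ ^ (1 - p) * ‖f z‖ ^ p := by
          rw [← Real.rpow_add hfz, sub_add_cancel, Real.rpow_one]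
      _ ≤ M * ‖f z‖ ^ p := by
          gcongr; exact Real.rpow_le_rpow hfz.le h1 (by linarith)
  have hid : ‖f z₀‖ * ρ ^ (2 * n) = M * (S ^ p * (1 / 2) ^ K) := by
    have h1 : ρ ^ (2 * n) = R ^ p := by
      rw [hR, ← Real.rpow_mul hρ0.le, hK, div_mul_cancel₀ _ hp.ne', ← Real.rpow_natCast]
      push_cast; rfl
    have h2 : S = 2 ^ K * R * ‖f z₀‖ := by
      rw [hS, hR, ← Real.mul_rpow (by norm_num) hρ0.le, hρ]
      congr 2; ring
    have h3 : M = S / R * (R ^ p / S ^ p) := by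
      rw [hM, Real.rpow_sub (div_pos hS0 hR0), Real.rpow_one, Real.div_rpow hS0.le hR0.le]
      field_simp
    have h4 : ‖f z₀‖ = S / (2 ^ K * R) := by rw [h2]; field_simp
    have h5 : 0 < S ^ p := Real.rpow_pos_of_pos hS0 _
    have h6 : (0 : ℝ) < 2 ^ K := by positivity
    rw [h1, h3, h4, Real.div_rpow zero_le_one (by norm_num), Real.one_rpow]
    field_simp
  have hM1 : ENNReal.ofReal M ≠ 0 := by simpa using hM0
  rw [← ENNReal.mul_le_mul_iff_right hM1 ENNReal.ofReal_ne_top]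
  have hθ : (((1 / 2 : ℝ≥0) ^ K : ℝ≥0) : ℝ≥0∞) = ENNReal.ofReal ((1 / 2) ^ K) := by
    rw [ENNReal.ofReal, Real.toNNReal_rpow_of_nonneg (by norm_num)]
    congr 2
    ext; norm_num
  calc ENNReal.ofReal M * ((((1 / 2 : ℝ≥0) ^ K : ℝ≥0) : ℝ≥0∞) * volume (unitBall n))
      = ENNReal.ofReal (M * (1 / 2) ^ K) * volume (unitBall n) := by
        rw [hθ, ← mul_assoc, ENNReal.ofReal_mul hM0.le]
    _ ≤ ENNReal.ofReal (M * (S ^ p * (1 / 2) ^ K)) * volume (unitBall n) := by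
        gcongr
        exact le_mul_of_one_le_left (by positivity) (Real.one_le_rpow hS1 hp.le)
    _ = ‖f z₀‖ₑ * volume (Metric.ball z₀ ρ) := by
        rw [← hid, volume_ball_eq _ hρ0, ENNReal.ofReal_mul (norm_nonneg _), ofReal_norm, mul_assoc]
    _ ≤ ∫⁻ z in Metric.ball z₀ ρ, ‖f z‖ₑ := enorm_mul_volume_ball_le (hd.mono hsub')
    _ ≤ ∫⁻ z in Metric.ball z₀ ρ, ENNReal.ofReal M * ((‖f z‖₊ ^ p : ℝ≥0) : ℝ≥0∞) := by
        refine setLIntegral_mono' Metric.isOpen_ball.measurableSet fun z hz => ?_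
        rw [ENNReal.ofReal, ← ENNReal.coe_mul, ← ofReal_norm, ENNReal.ofReal]
        refine ENNReal.coe_le_coe.2 (Real.toNNReal_le_iff_le_coe.2 ?_)
        rw [NNReal.coe_mul, Real.coe_toNNReal _ hM0.le]
        exact hle z hz
    _ = ENNReal.ofReal M * ∫⁻ z in Metric.ball z₀ ρ, ((‖f z‖₊ ^ p : ℝ≥0) : ℝ≥0∞) :=
        lintegral_const_mul' _ _ ENNReal.ofReal_ne_top
    _ ≤ ENNReal.ofReal M * ∫⁻ z in unitBall n, ((‖f z‖₊ ^ p : ℝ≥0) : ℝ≥0∞) := by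
        gcongr

/-- A sub-mean value inequality for `Φ(|f|)`. -/
theorem PowerBounds.exists_map_nnnorm_le {p q : ℝ} {C : ℝ≥0} {Φ : ℝ≥0 → ℝ≥0}
    (h : PowerBounds p q C Φ) {n : ℕ} (hn : 1 ≤ n) :
    ∃ A : ℝ≥0, ∀ f : EuclideanSpace ℂ (Fin n) → ℂ,
      ContinuousOn f (Metric.closedBall 0 1) → DifferentiableOn ℂ f (unitBall n) →
        (Φ ‖f 0‖₊ : ℝ≥0∞) ≤ A * ∫⁻ z in unitBall n, (Φ ‖f z‖₊ : ℝ≥0∞) := by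
  obtain ⟨θ, hθ, hθ1, hsub⟩ := exists_le_lintegral_rpow hn h.lower_pos h.lower_le_one
  -- With η = θ/2, the error term takes only half of the lower bound θ vol(B) and can be subtracted.
  obtain ⟨A, hA⟩ := h.exists_rpow_div_le (half_pos hθ) ((half_le_self hθ.le).trans hθ1)
  obtain ⟨v, hv⟩ : ∃ v : ℝ≥0, (v : ℝ≥0∞) = volume (unitBall n) :=
    ⟨_, ENNReal.coe_toNNReal measure_ball_lt_top.ne⟩
  have hv0 : 0 < v := by
    have : (v : ℝ≥0∞) ≠ 0 := hv ▸ (Metric.measure_ball_pos _ _ one_pos).ne'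
    exact pos_iff_ne_zero.2 (by exact_mod_cast this)
  refine ⟨A / (θ / 2 * v), fun f hc hd => ?_⟩
  rcases eq_or_ne (f 0) 0 with h0 | h0
  · simp [h0, h.growth.map_zero]
  have hx : 0 < ‖f 0‖₊ := nnnorm_pos.2 h0
  have hΦ := h.map_pos hx
  have h1 := hsub (fun z => f z / f 0) (hc.div_const _) (by simp only [div_eq_mul_inv]; exact hd.mul_const _)
    (by rw [div_self h0, norm_one])
  rw [← hv] at h1
  set I := ∫⁻ z in unitBall n, (Φ ‖f z‖₊ : ℝ≥0∞) with hI
  have h2 : ∫⁻ z in unitBall n, ((‖f z / f 0‖₊ ^ p : ℝ≥0) : ℝ≥0∞) ≤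
      (θ / 2 : ℝ≥0) * v + (A / Φ ‖f 0‖₊ : ℝ≥0) * I := by
    calc ∫⁻ z in unitBall n, ((‖f z / f 0‖₊ ^ p : ℝ≥0) : ℝ≥0∞)
        ≤ ∫⁻ z in unitBall n,
            ((θ / 2 : ℝ≥0) : ℝ≥0∞) + (A / Φ ‖f 0‖₊ : ℝ≥0) * (Φ ‖f z‖₊ : ℝ≥0∞) := by
          refine lintegral_mono fun z => ?_
          rw [nnnorm_div]
          refine (ENNReal.coe_le_coe.2 (hA ‖f 0‖₊ ‖f z‖₊ hx)).trans_eq ?_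
          push_cast [← ENNReal.coe_mul]
          congr 2
          field_simp
      _ = _ := by
          rw [lintegral_add_left measurable_const, setLIntegral_const, ← hv,
            lintegral_const_mul' _ _ ENNReal.coe_ne_top]
  have h3 : ((θ / 2 * v : ℝ≥0) : ℝ≥0∞) ≤ (A / Φ ‖f 0‖₊ : ℝ≥0) * I := by
    have h4 := h1.trans h2
    rw [← ENNReal.coe_mul, ← ENNReal.coe_mul] at h4
    have h5 : θ * v = θ / 2 * v + θ / 2 * v := by rw [← add_mul, add_halves]
    rw [h5, ENNReal.coe_add] at h4
    exact (ENNReal.add_le_add_iff_left ENNReal.coe_ne_top).1 h4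
  calc (Φ ‖f 0‖₊ : ℝ≥0∞)
      = (Φ ‖f 0‖₊ / (θ / 2 * v) : ℝ≥0) * ((θ / 2 * v : ℝ≥0) : ℝ≥0∞) := by
        rw [← ENNReal.coe_mul]; congr 1; field_simp
    _ ≤ (Φ ‖f 0‖₊ / (θ / 2 * v) : ℝ≥0) * ((A / Φ ‖f 0‖₊ : ℝ≥0) * I) := by gcongr
    _ = (A / (θ / 2 * v) : ℝ≥0) * I := by
        rw [← mul_assoc, ← ENNReal.coe_mul]; congr 2; field_simp

/-! ### Anisotropic dilations -/

/-- The linear map that multiplies by `a` along `e` and by `b` orthogonally to `e`, for a unit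
vector `e`. -/
def aniso {n : ℕ} (e : EuclideanSpace ℂ (Fin n)) (a b : ℝ) :
    EuclideanSpace ℂ (Fin n) →ₗ[ℂ] EuclideanSpace ℂ (Fin n) :=
  (b : ℂ) • LinearMap.transvection (((a / b : ℝ) - 1 : ℂ) • (innerSL ℂ e).toLinearMap) e

section Aniso

variable {n : ℕ} {e : EuclideanSpace ℂ (Fin n)} {a b : ℝ}

theorem aniso_apply (hb : b ≠ 0) (z : EuclideanSpace ℂ (Fin n)) :
    aniso e a b z = (b : ℂ) • z + ((a - b : ℂ) * inner ℂ e z) • e := by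
  have hb' : (b : ℂ) ≠ 0 := by exact_mod_cast hb
  simp only [aniso, LinearMap.smul_apply, LinearMap.transvection.apply, smul_add, smul_smul]
  congr 2
  simp only [ContinuousLinearMap.coe_coe, innerSL_apply_apply, smul_eq_mul]
  push_cast
  field_simp

theorem det_aniso (he : ‖e‖ = 1) :
    LinearMap.det ((aniso e a b).restrictScalars ℝ) = (b ^ n * (a / b)) ^ 2 := by
  have h1 : LinearMap.det (aniso e a b) = ((b ^ n * (a / b) : ℝ) : ℂ) := by
    rw [aniso, LinearMap.det_smul, LinearMap.transvection.det]
    simp [he]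
  rw [LinearMap.det_restrictScalars, h1, Algebra.norm_complex_eq]
  exact (Complex.normSq_ofReal _).trans (sq _).symm

theorem lintegral_comp_aniso (he : ‖e‖ = 1) (ha : a ≠ 0) (hb : b ≠ 0)
    (c : EuclideanSpace ℂ (Fin n)) (F : EuclideanSpace ℂ (Fin n) → ℝ≥0∞) :
    ∫⁻ z, F (c + aniso e a b z) = ENNReal.ofReal ((b ^ n * (a / b)) ^ 2)⁻¹ * ∫⁻ z, F z := by
  have hdet : LinearMap.det ((aniso e a b).restrictScalars ℝ) ≠ 0 := by
    rw [det_aniso he]; positivity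
  have hmap := Measure.map_linearMap_addHaar_eq_smul_addHaar
    (volume : Measure (EuclideanSpace ℂ (Fin n))) hdet
  rw [det_aniso he, abs_of_nonneg (by positivity)] at hmap
  set T := (((aniso e a b).restrictScalars ℝ).equivOfDetNeZero
    hdet).toContinuousLinearEquiv.toHomeomorph.toMeasurableEquiv with hT
  have hT' : ∀ z, T z = aniso e a b z := fun z => rfl
  have h2 : Measure.map T volume = ENNReal.ofReal ((b ^ n * (a / b)) ^ 2)⁻¹ • volume := hmap
  have h3 := lintegral_map_equiv (μ := volume) (fun z => F (c + z)) T
  rw [h2, lintegral_smul_measure, lintegral_add_left_eq_self F c] at h3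
  exact h3.symm

theorem inner_aniso (he : ‖e‖ = 1) (hb : b ≠ 0) (z : EuclideanSpace ℂ (Fin n)) :
    inner ℂ e (aniso e a b z) = a * inner ℂ e z := by
  rw [aniso_apply hb, inner_add_right, inner_smul_right, inner_smul_right,
    inner_self_eq_norm_sq_to_K, he]
  push_cast; ring

theorem aniso_sub (he : ‖e‖ = 1) (hb : b ≠ 0) (z : EuclideanSpace ℂ (Fin n)) :
    aniso e a b z - inner ℂ e (aniso e a b z) • e = (b : ℂ) • (z - inner ℂ e z • e) := by
  rw [inner_aniso he hb, aniso_apply hb]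
  module

theorem norm_sq_eq_add (he : ‖e‖ = 1) (z : EuclideanSpace ℂ (Fin n)) :
    ‖z‖ ^ 2 = ‖inner ℂ e z‖ ^ 2 + ‖z - inner ℂ e z • e‖ ^ 2 := by
  have h : inner ℂ (inner ℂ e z • e) (z - inner ℂ e z • e) = 0 := by
    rw [inner_smul_left, inner_sub_right, inner_smul_right, inner_self_eq_norm_sq_to_K, he]
    simp
  have := norm_add_sq_eq_norm_sq_add_norm_sq_of_inner_eq_zero _ _ h
  rw [add_sub_cancel, norm_smul, he, mul_one] at this
  simpa [sq] using this

theorem exists_unit_smul (hn : 1 ≤ n) (z : EuclideanSpace ℂ (Fin n)) :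
    ∃ e : EuclideanSpace ℂ (Fin n), ‖e‖ = 1 ∧ z = (‖z‖ : ℂ) • e := by
  rcases eq_or_ne z 0 with rfl | hz
  · exact ⟨EuclideanSpace.single ⟨0, hn⟩ 1, by simp, by simp⟩
  · have hz' : (‖z‖ : ℂ) ≠ 0 := by exact_mod_cast (norm_pos_iff.2 hz).ne'
    refine ⟨(‖z‖ : ℂ)⁻¹ • z, ?_, ?_⟩
    · rw [norm_smul]; simp [hz]
    · rw [smul_smul, mul_inv_cancel₀ hz', one_smul]

/-- An orthogonal displacement enters |ζ|² only through its square, so size √(1-r) is allowed in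
those directions. The neighbourhood of re then stays in the ball, and the weight is nearly constant
on it. -/
theorem one_sub_norm_sq_bounds (he : ‖e‖ = 1) {r : ℝ} (hr : 0 ≤ r) (hr1 : r < 1)
    {w : EuclideanSpace ℂ (Fin n)} (hw : ‖w‖ ≤ 1) :
    (1 - r) / 2 ≤ 1 - ‖(r : ℂ) • e + aniso e ((1 - r) / 4) (√(1 - r) / 4) w‖ ^ 2 ∧
      1 - ‖(r : ℂ) • e + aniso e ((1 - r) / 4) (√(1 - r) / 4) w‖ ^ 2 ≤ 4 * (1 - r) := by
  have hδ : 0 < 1 - r := sub_pos.2 hr1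
  have hb : √(1 - r) / 4 ≠ 0 := by positivity
  set ζ := (r : ℂ) • e + aniso e ((1 - r) / 4) (√(1 - r) / 4) w with hζ
  have h1 : inner ℂ e ζ = r + ((1 - r) / 4 : ℝ) * inner ℂ e w := by
    rw [hζ, inner_add_right, inner_smul_right, inner_self_eq_norm_sq_to_K, he, inner_aniso he hb]
    simp
  have h2 : ζ - inner ℂ e ζ • e = ((√(1 - r) / 4 : ℝ) : ℂ) • (w - inner ℂ e w • e) := by
    rw [← aniso_sub he hb (a := (1 - r) / 4), inner_aniso he hb, h1, hζ]
    module
  have h3 := norm_sq_eq_add he ζ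
  have h4 := norm_sq_eq_add he w
  have hω : ‖inner ℂ e w‖ ≤ 1 := by
    calc ‖inner ℂ e w‖ ≤ ‖e‖ * ‖w‖ := norm_inner_le_norm _ _
      _ ≤ 1 := by rw [he, one_mul]; exact hw
  have hQ : ‖w - inner ℂ e w • e‖ ^ 2 ≤ 1 := by nlinarith [norm_nonneg w, sq_nonneg ‖inner ℂ e w‖]
  have hQ2 : ‖ζ - inner ℂ e ζ • e‖ ^ 2 ≤ (1 - r) / 16 := by
    rw [h2, norm_smul, mul_pow, Complex.norm_real, Real.norm_eq_abs, sq_abs, div_pow,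
      Real.sq_sqrt hδ.le]
    nlinarith
  have hm : ‖((1 - r) / 4 : ℝ) * inner ℂ e w‖ ≤ (1 - r) / 4 := by
    rw [norm_mul, Complex.norm_real, Real.norm_of_nonneg (by positivity)]
    nlinarith
  have hr' : ‖(r : ℂ)‖ = r := by rw [Complex.norm_real, Real.norm_of_nonneg hr]
  have hup : ‖inner ℂ e ζ‖ ≤ r + (1 - r) / 4 := by
    rw [h1]; exact (norm_add_le _ _).trans (by rw [hr']; gcongr)
  have hlo : r - (1 - r) / 4 ≤ ‖inner ℂ e ζ‖ := by
    rw [h1]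
    have := norm_sub_le_norm_add (r : ℂ) (((1 - r) / 4 : ℝ) * inner ℂ e w)
    rw [hr'] at this
    linarith
  have h0 := norm_nonneg (inner ℂ e ζ)
  constructor
  · nlinarith
  -- In the second case r ≤ 1/5, so 4(1-r) already exceeds 1.
  · rcases le_total 0 (r - (1 - r) / 4) with h | h
    · nlinarith [sq_nonneg ‖ζ - inner ℂ e ζ • e‖]
    · nlinarith [sq_nonneg ‖ζ‖]

end Aniso

/-! ### The pointwise estimate -/

theorem rpow_le_of_comparable {x y : ℝ} (hx : 0 < x) (hy : 0 < y) (h1 : x ≤ 4 * y)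
    (h2 : y ≤ 4 * x) (α : ℝ) : x ^ α ≤ 4 ^ |α| * y ^ α := by
  rcases le_total 0 α with hα | hα
  · rw [abs_of_nonneg hα, ← Real.mul_rpow (by norm_num) hy.le]
    exact Real.rpow_le_rpow hx.le h1 hα
  · have h3 := Real.rpow_le_rpow_of_nonpos hy h2 hα
    rw [Real.mul_rpow (by norm_num) hx.le] at h3
    rw [abs_of_nonpos hα, Real.rpow_neg (by norm_num), inv_mul_eq_div, le_div_iff₀ (by positivity),
      mul_comm]
    exact h3

theorem measurable_weight (n : ℕ) (α : ℝ) :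
    Measurable fun z : EuclideanSpace ℂ (Fin n) => ENNReal.ofReal ((1 - ‖z‖ ^ 2) ^ α) := by
  fun_prop

theorem lintegral_preMeasure (n : ℕ) (α : ℝ) (F : EuclideanSpace ℂ (Fin n) → ℝ≥0∞) :
    ∫⁻ z, F z ∂(preMeasure n α) =
      ∫⁻ z in unitBall n, ENNReal.ofReal ((1 - ‖z‖ ^ 2) ^ α) * F z :=
  lintegral_withDensity_eq_lintegral_mul_non_measurable _ (measurable_weight n α)
    (ae_of_all _ fun _ => ENNReal.ofReal_lt_top) F

theorem one_sub_norm_pos {n : ℕ} {z : EuclideanSpace ℂ (Fin n)} (hz : z ∈ unitBall n) :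
    0 < 1 - ‖z‖ := sub_pos.2 (mem_ball_zero_iff.1 hz)

theorem one_sub_norm_sq_pos {n : ℕ} {z : EuclideanSpace ℂ (Fin n)} (hz : z ∈ unitBall n) :
    0 < 1 - ‖z‖ ^ 2 := by
  nlinarith [one_sub_norm_pos hz, norm_nonneg z]

/-- Pull the inequality at the centre of the ball back to z by an anisotropic dilation. Its real
Jacobian is δ^(n+1)/16^n with δ = 1-|z|, and the weight is comparable to δ^α; Euclidean balls would
give the worse exponent 2n + α. -/
theorem PowerBounds.exists_map_nnnorm_le_preMeasure {p q : ℝ} {C : ℝ≥0} {Φ : ℝ≥0 → ℝ≥0}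
    (h : PowerBounds p q C Φ) {n : ℕ} (hn : 1 ≤ n) (α : ℝ) :
    ∃ A : ℝ≥0, ∀ f ∈ holo n, ∀ z ∈ unitBall n,
      (Φ ‖f z‖₊ : ℝ≥0∞) ≤ A * ENNReal.ofReal ((1 - ‖z‖) ^ (-((n : ℝ) + 1 + α))) *
        ∫⁻ w, (Φ ‖f w‖₊ : ℝ≥0∞) ∂(preMeasure n α) := by
  obtain ⟨A, hA⟩ := h.exists_map_nnnorm_le hn
  refine ⟨A * (4 ^ |α| * 16 ^ n), fun f hf z hz => ?_⟩
  obtain ⟨e, he, hze⟩ := exists_unit_smul hn z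
  have hδ := one_sub_norm_pos hz
  set δ := 1 - ‖z‖ with hδ'
  set T := aniso e (δ / 4) (√δ / 4) with hT
  have hbd : ∀ w : EuclideanSpace ℂ (Fin n), ‖w‖ ≤ 1 →
      δ / 2 ≤ 1 - ‖z + T w‖ ^ 2 ∧ 1 - ‖z + T w‖ ^ 2 ≤ 4 * δ := by
    intro w hw
    have := one_sub_norm_sq_bounds he (norm_nonneg z) (mem_ball_zero_iff.1 hz) hw
    rwa [← hze] at this
  have hmem : ∀ w : EuclideanSpace ℂ (Fin n), ‖w‖ ≤ 1 → z + T w ∈ unitBall n := by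
    intro w hw
    rw [mem_ball_zero_iff]
    nlinarith [(hbd w hw).1, norm_nonneg (z + T w)]
  have hmaps : MapsTo (fun w => z + T w) (Metric.closedBall 0 1) (unitBall n) :=
    fun w hw => hmem w (mem_closedBall_zero_iff.1 hw)
  have hTd : Differentiable ℂ (fun w => z + T w) :=
    (T.toContinuousLinearMap.differentiable).const_add z
  have h1 := hA (fun w => f (z + T w))
    (hf.continuousOn.comp hTd.continuous.continuousOn hmaps)
    (hf.comp hTd.differentiableOn (hmaps.mono_left Metric.ball_subset_closedBall))
  simp only [map_zero, add_zero] at h1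
  set G : EuclideanSpace ℂ (Fin n) → ℝ≥0∞ := (unitBall n).indicator
    fun ζ => ENNReal.ofReal ((1 - ‖ζ‖ ^ 2) ^ α) * (Φ ‖f ζ‖₊ : ℝ≥0∞) with hG
  have hGi : ∫⁻ w, (Φ ‖f w‖₊ : ℝ≥0∞) ∂(preMeasure n α) = ∫⁻ ζ, G ζ := by
    rw [lintegral_preMeasure, ← lintegral_indicator Metric.isOpen_ball.measurableSet]
  have hpt : ∀ w ∈ unitBall n, (Φ ‖f (z + T w)‖₊ : ℝ≥0∞) ≤
      ENNReal.ofReal (4 ^ |α| * δ ^ (-α)) * G (z + T w) := by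
    intro w hw
    have hw1 : ‖w‖ ≤ 1 := (mem_ball_zero_iff.1 hw).le
    have hin := hmem w hw1
    obtain ⟨hb1, hb2⟩ := hbd w hw1
    rw [hG, indicator_of_mem hin, ← mul_assoc, ← ENNReal.ofReal_mul (by positivity)]
    refine le_mul_of_one_le_left' (ENNReal.one_le_ofReal.2 ?_)
    have := rpow_le_of_comparable hδ (one_sub_norm_sq_pos hin) (by linarith) (by linarith) α
    calc (1 : ℝ) = δ ^ α * δ ^ (-α) := by rw [← Real.rpow_add hδ, add_neg_cancel, Real.rpow_zero]
      _ ≤ (4 ^ |α| * (1 - ‖z + T w‖ ^ 2) ^ α) * δ ^ (-α) := by gcongr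
      _ = _ := by ring
  have hdet : ((((√δ / 4) ^ n * (δ / 4 / (√δ / 4))) ^ 2)⁻¹ : ℝ) =
      16 ^ n * δ ^ (-((n : ℝ) + 1)) := by
    have h5 : δ / 4 / (√δ / 4) = √δ := by
      rw [div_div_div_cancel_right₀ (by norm_num), Real.div_sqrt]
    rw [h5, mul_pow, Real.sq_sqrt hδ.le, ← pow_mul, mul_comm n 2, pow_mul, div_pow,
      Real.sq_sqrt hδ.le, Real.rpow_neg hδ.le, Real.rpow_add hδ, Real.rpow_one, Real.rpow_natCast,
      div_pow]
    field_simp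
    norm_num
  calc (Φ ‖f z‖₊ : ℝ≥0∞) ≤ A * ∫⁻ w in unitBall n, (Φ ‖f (z + T w)‖₊ : ℝ≥0∞) := h1
    _ ≤ A * ∫⁻ w in unitBall n, ENNReal.ofReal (4 ^ |α| * δ ^ (-α)) * G (z + T w) := by
        exact mul_le_mul_right (setLIntegral_mono' Metric.isOpen_ball.measurableSet hpt) _
    _ ≤ A * ∫⁻ w, ENNReal.ofReal (4 ^ |α| * δ ^ (-α)) * G (z + T w) := by
        exact mul_le_mul_right (setLIntegral_le_lintegral _ _) _
    _ = A * (ENNReal.ofReal (4 ^ |α| * δ ^ (-α)) *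
          (ENNReal.ofReal (16 ^ n * δ ^ (-((n : ℝ) + 1))) * ∫⁻ ζ, G ζ)) := by
        rw [lintegral_const_mul' _ _ ENNReal.ofReal_ne_top,
          lintegral_comp_aniso he (by positivity) (by positivity), hdet]
    _ = _ := by
        have h6 : (((4 ^ |α| * 16 ^ n : ℝ≥0)) : ℝ≥0∞) = ENNReal.ofReal (4 ^ |α| * 16 ^ n) := by
          rw [ENNReal.ofReal]
          congr 1
          rw [Real.toNNReal_mul (by positivity), Real.toNNReal_rpow_of_nonneg (by norm_num),
            Real.toNNReal_pow (by norm_num)]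
          norm_num
        have h7 : 4 ^ |α| * δ ^ (-α) * (16 ^ n * δ ^ (-((n : ℝ) + 1))) =
            4 ^ |α| * 16 ^ n * δ ^ (-((n : ℝ) + 1 + α)) := by
          have : δ ^ (-((n : ℝ) + 1 + α)) = δ ^ (-α) * δ ^ (-((n : ℝ) + 1)) := by
            rw [← Real.rpow_add hδ]; congr 1; ring
          rw [this]; ring
        rw [hGi, ← mul_assoc (ENNReal.ofReal _), ← ENNReal.ofReal_mul (by positivity), h7,
          ENNReal.ofReal_mul (by positivity), ENNReal.coe_mul, h6]
        ring

/-! ### The measure of nonisotropic caps -/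

/-- Integration in polar coordinates of a radial function over a cone. -/
theorem lintegral_cone {n : ℕ} {S : Set (EuclideanSpace ℂ (Fin n))} (hn : 1 ≤ n)
    (hS : MeasurableSet S) {φ : ℝ → ℝ≥0∞} (hφ : Measurable φ) :
    ∫⁻ z, {z : EuclideanSpace ℂ (Fin n) | ‖z‖⁻¹ • z ∈ S}.indicator (fun z => φ ‖z‖) z =
      (volume : Measure (EuclideanSpace ℂ (Fin n))).toSphere ((↑) ⁻¹' S) *
        ∫⁻ r in Ioi (0 : ℝ), ENNReal.ofReal (r ^ (2 * n - 1)) * φ r := by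
  classical
  have : Nontrivial (EuclideanSpace ℂ (Fin n)) := by
    have : Nonempty (Fin n) := ⟨⟨0, hn⟩⟩
    infer_instance
  set μ : Measure (EuclideanSpace ℂ (Fin n)) := volume with hμ
  have hmp := μ.measurePreserving_homeomorphUnitSphereProd
  set G : Metric.sphere (0 : EuclideanSpace ℂ (Fin n)) 1 × Ioi (0 : ℝ) → ℝ≥0∞ :=
    fun p => ((↑) ⁻¹' S : Set (Metric.sphere (0 : EuclideanSpace ℂ (Fin n)) 1)).indicator 1 p.1 *
      φ p.2 with hG
  have hSm : MeasurableSet ((↑) ⁻¹' S : Set (Metric.sphere (0 : EuclideanSpace ℂ (Fin n)) 1)) :=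
    measurable_subtype_coe hS
  have hGm : Measurable G :=
    ((measurable_one.indicator hSm).comp measurable_fst).mul
      (hφ.comp (measurable_subtype_coe.comp measurable_snd))
  calc ∫⁻ z, {z : EuclideanSpace ℂ (Fin n) | ‖z‖⁻¹ • z ∈ S}.indicator (fun z => φ ‖z‖) z ∂μ
      = ∫⁻ z in {0}ᶜ,
          {z : EuclideanSpace ℂ (Fin n) | ‖z‖⁻¹ • z ∈ S}.indicator (fun z => φ ‖z‖) z ∂μ := by
        have hae : μ.restrict {0}ᶜ = μ :=
          Measure.restrict_eq_self_of_ae_mem (compl_mem_ae_iff.2 (measure_singleton _))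
        rw [hae]
    _ = ∫⁻ x : ({0}ᶜ : Set (EuclideanSpace ℂ (Fin n))), G (homeomorphUnitSphereProd _ x)
          ∂(μ.comap (↑)) := by
        rw [← lintegral_subtype_comap (measurableSet_singleton _).compl]
        refine lintegral_congr fun x => ?_
        simp only [hG, indicator, mem_preimage]
        simp
    _ = ∫⁻ p, G p ∂(μ.toSphere.prod (Measure.volumeIoiPow (2 * n - 1))) := by
        rw [hmp.lintegral_comp hGm, finrank_real_euclidean]
    _ = _ := by
        have := lintegral_prod_mul (μ := μ.toSphere) (ν := Measure.volumeIoiPow (2 * n - 1))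
          (measurable_one.indicator hSm).aemeasurable
          (hφ.comp measurable_subtype_coe).aemeasurable
        refine this.trans ?_
        rw [lintegral_indicator_one hSm,
          Measure.volumeIoiPow, lintegral_withDensity_eq_lintegral_mul _ (by fun_prop)
          (hφ.comp measurable_subtype_coe), ← lintegral_subtype_comap measurableSet_Ioi]
        rfl

theorem lintegral_Ioo_one_sub_rpow {α h : ℝ} (hα : -1 < α) (hh : 0 < h) :
    ∫⁻ r in Ioo (1 - h) 1, ENNReal.ofReal ((1 - r) ^ α) =
      ENNReal.ofReal (h ^ (α + 1) / (α + 1)) := by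
  have h1 : ∫⁻ r in Ioo (1 - h) 1, ENNReal.ofReal ((1 - r) ^ α) =
      ∫⁻ x in Ioo 0 h, ENNReal.ofReal (x ^ α) := by
    rw [← lintegral_indicator measurableSet_Ioo, ← lintegral_indicator measurableSet_Ioo,
      ← lintegral_sub_left_eq_self _ (1 : ℝ)]
    refine lintegral_congr fun r => ?_
    simp only [indicator, mem_Ioo]
    congr 1
    · simp only [eq_iff_iff]; constructor <;> rintro ⟨h1, h2⟩ <;> constructor <;> linarith
    · rw [sub_sub_cancel]
  rw [h1, Measure.restrict_congr_set Ioo_ae_eq_Ioc, ← ofReal_integral_eq_lintegral_ofReal,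
    ← intervalIntegral.integral_of_le hh.le, integral_rpow (Or.inl hα),
    Real.zero_rpow (by linarith), sub_zero]
  · exact (intervalIntegral.intervalIntegrable_rpow' hα).1
  · filter_upwards [ae_restrict_mem measurableSet_Ioc] with x hx
    exact Real.rpow_nonneg hx.1.le _

/-- The part of the radial weight `(1 - r ^ 2) ^ α` on `(1 - h, 1)`. -/
def shellWeight (α h : ℝ) : ℝ → ℝ≥0∞ :=
  (Ioo (1 - h) 1).indicator fun r => ENNReal.ofReal ((1 - r ^ 2) ^ α)

theorem measurable_shellWeight (α h : ℝ) : Measurable (shellWeight α h) :=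
  Measurable.indicator (by fun_prop) measurableSet_Ioo

theorem lintegral_shellWeight_le {α h : ℝ} (hα : -1 < α) (hh : 0 < h) (hh1 : h ≤ 1) (m : ℕ) :
    ∫⁻ r in Ioi (0 : ℝ), ENNReal.ofReal (r ^ m) * shellWeight α h r ≤
      ENNReal.ofReal (4 ^ |α| * (h ^ (α + 1) / (α + 1))) := by
  calc ∫⁻ r in Ioi (0 : ℝ), ENNReal.ofReal (r ^ m) * shellWeight α h r
      ≤ ∫⁻ r, (Ioo (1 - h) 1).indicator
          (fun r => ENNReal.ofReal (4 ^ |α|) * ENNReal.ofReal ((1 - r) ^ α)) r := by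
        refine (setLIntegral_le_lintegral _ _).trans (lintegral_mono fun r => ?_)
        rw [shellWeight]
        by_cases hr : r ∈ Ioo (1 - h) 1
        · rw [indicator_of_mem hr, indicator_of_mem hr,
            ← ENNReal.ofReal_mul (p := (4 : ℝ) ^ |α|) (by positivity)]
          obtain ⟨h1, h2⟩ := hr
          have h3 : 0 ≤ r := by linarith
          have h4 := rpow_le_of_comparable (x := 1 - r ^ 2) (y := 1 - r) (by nlinarith)
            (by linarith) (by nlinarith) (by nlinarith) α
          calc ENNReal.ofReal (r ^ m) * ENNReal.ofReal ((1 - r ^ 2) ^ α)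
              ≤ 1 * ENNReal.ofReal ((1 - r ^ 2) ^ α) := by
                gcongr
                exact ENNReal.ofReal_le_one.2 (pow_le_one₀ h3 h2.le)
            _ ≤ _ := by rw [one_mul]; exact ENNReal.ofReal_le_ofReal h4
        · rw [indicator_of_notMem hr, mul_zero]; exact zero_le
    _ = _ := by
        rw [lintegral_indicator measurableSet_Ioo, lintegral_const_mul' _ _ ENNReal.ofReal_ne_top,
          lintegral_Ioo_one_sub_rpow hα hh, ENNReal.ofReal_mul (by positivity)]

/-- The unweighted shell is bounded below so that the spherical measure of a cap can be recovered
from a Lebesgue measure; h ≤ 1/2 keeps r ≥ 1/2. -/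
theorem le_lintegral_shellWeight_zero {h : ℝ} (hh1 : h ≤ 1 / 2) (m : ℕ) :
    ENNReal.ofReal ((1 / 2) ^ m * h) ≤
      ∫⁻ r in Ioi (0 : ℝ), ENNReal.ofReal (r ^ m) * shellWeight 0 h r := by
  calc ENNReal.ofReal ((1 / 2) ^ m * h)
      = ∫⁻ r in Ioo (1 - h) 1, ENNReal.ofReal ((1 / 2) ^ m) := by
        rw [setLIntegral_const, Real.volume_Ioo, sub_sub_cancel, ENNReal.ofReal_mul (by positivity)]
    _ ≤ ∫⁻ r in Ioo (1 - h) 1, ENNReal.ofReal (r ^ m) * shellWeight 0 h r := by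
        refine setLIntegral_mono' measurableSet_Ioo fun r hr => ?_
        rw [shellWeight, indicator_of_mem hr, Real.rpow_zero, ENNReal.ofReal_one, mul_one]
        refine ENNReal.ofReal_le_ofReal (pow_le_pow_left₀ (by norm_num) ?_ _)
        linarith [hr.1]
    _ ≤ _ := lintegral_mono_set fun r hr => by
        rw [mem_Ioi]; linarith [hr.1]

theorem preMeasure_eq_lintegral (n : ℕ) (α : ℝ) (s : Set (EuclideanSpace ℂ (Fin n)))
    (hs : MeasurableSet s) :
    preMeasure n α s = ∫⁻ z, (unitBall n ∩ s).indicator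
      (fun z => ENNReal.ofReal ((1 - ‖z‖ ^ 2) ^ α)) z := by
  rw [preMeasure, withDensity_apply _ hs, Measure.restrict_restrict hs, inter_comm,
    lintegral_indicator (Metric.isOpen_ball.measurableSet.inter hs)]

theorem preMeasure_univ_lt_top {n : ℕ} (hn : 1 ≤ n) {α : ℝ} (hα : -1 < α) :
    preMeasure n α univ < ∞ := by
  rw [← lintegral_one, lintegral_preMeasure, ← lintegral_indicator Metric.isOpen_ball.measurableSet]
  have h1 := lintegral_cone hn MeasurableSet.univ (measurable_shellWeight α 1)
  have h2 : ∀ᵐ z : EuclideanSpace ℂ (Fin n),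
      (unitBall n).indicator (fun z => ENNReal.ofReal ((1 - ‖z‖ ^ 2) ^ α) * 1) z =
      {z : EuclideanSpace ℂ (Fin n) | ‖z‖⁻¹ • z ∈ univ}.indicator
        (fun z => shellWeight α 1 ‖z‖) z := by
    have : Nontrivial (EuclideanSpace ℂ (Fin n)) := by
      have : Nonempty (Fin n) := ⟨⟨0, hn⟩⟩
      infer_instance
    have h0 : ∀ᵐ z : EuclideanSpace ℂ (Fin n), z ≠ 0 :=
      compl_mem_ae_iff.2 (measure_singleton _)
    filter_upwards [h0] with z hz
    rw [indicator_of_mem (s := {z : EuclideanSpace ℂ (Fin n) | ‖z‖⁻¹ • z ∈ univ}) (mem_univ _),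
      shellWeight]
    by_cases hz1 : z ∈ unitBall n
    · rw [indicator_of_mem hz1, indicator_of_mem, mul_one]
      exact ⟨by simpa using hz, mem_ball_zero_iff.1 hz1⟩
    · rw [indicator_of_notMem hz1, indicator_of_notMem]
      exact fun h => hz1 (mem_ball_zero_iff.2 h.2)
  rw [lintegral_congr_ae h2, h1]
  exact ENNReal.mul_lt_top (measure_lt_top _ _)
    ((lintegral_shellWeight_le hα one_pos le_rfl _).trans_lt ENNReal.ofReal_lt_top)

/-- The nonisotropic cap `{z : |1 - ⟨e, z⟩| < h}`. -/
def cap {n : ℕ} (e : EuclideanSpace ℂ (Fin n)) (h : ℝ) : Set (EuclideanSpace ℂ (Fin n)) :=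
  {z | ‖1 - inner ℂ e z‖ < h}

theorem measurableSet_cap {n : ℕ} (e : EuclideanSpace ℂ (Fin n)) (h : ℝ) :
    MeasurableSet (cap e h) := by
  refine (isOpen_lt ?_ continuous_const).measurableSet
  fun_prop

/-- Rescaling by h along e and √h across it gives the factor h^(n+1). The preimage has |⟨e,w⟩| < 1
and squared orthogonal part at most 2, since 1-|⟨e,ζ⟩|² ≤ 2h, hence lies in the ball of radius 2. -/
theorem volume_cap_le {n : ℕ} {e : EuclideanSpace ℂ (Fin n)} (he : ‖e‖ = 1) {h : ℝ} (hh : 0 < h) :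
    volume (unitBall n ∩ cap e h) ≤
      ENNReal.ofReal (h ^ (n + 1)) * volume (Metric.ball (0 : EuclideanSpace ℂ (Fin n)) 2) := by
  have hm : MeasurableSet (unitBall n ∩ cap e h) :=
    Metric.isOpen_ball.measurableSet.inter (measurableSet_cap e h)
  have hb : √h ≠ 0 := by positivity
  have hdet : (√h ^ n * (h / √h)) ^ 2 = h ^ (n + 1) := by
    rw [Real.div_sqrt, mul_pow, Real.sq_sqrt hh.le, ← pow_mul, mul_comm n 2, pow_mul,
      Real.sq_sqrt hh.le, pow_succ]
  have hpos : 0 < h ^ (n + 1) := by positivity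
  have h1 := lintegral_comp_aniso he hh.ne' hb e ((unitBall n ∩ cap e h).indicator 1)
  rw [lintegral_indicator_one hm, hdet] at h1
  have h2 : ∫⁻ w, (unitBall n ∩ cap e h).indicator 1 (e + aniso e h (√h) w) ≤
      volume (Metric.ball (0 : EuclideanSpace ℂ (Fin n)) 2) := by
    rw [← lintegral_indicator_one Metric.isOpen_ball.measurableSet]
    refine lintegral_mono fun w => ?_
    by_cases hw : e + aniso e h (√h) w ∈ unitBall n ∩ cap e h
    · rw [indicator_of_mem hw, indicator_of_mem]
      · simp
      obtain ⟨hw1, hw2⟩ := hw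
      set ζ := e + aniso e h (√h) w with hζ
      have h3 : inner ℂ e ζ = 1 + h * inner ℂ e w := by
        rw [hζ, inner_add_right, inner_self_eq_norm_sq_to_K, he, inner_aniso he hb]
        simp
      have h4 : ζ - inner ℂ e ζ • e = (√h : ℂ) • (w - inner ℂ e w • e) := by
        rw [← aniso_sub he hb (a := h), inner_aniso he hb, h3, hζ]
        module
      have h5 := norm_sq_eq_add he ζ
      have h6 := norm_sq_eq_add he w
      rw [h4, norm_smul, mul_pow, Complex.norm_real, Real.norm_eq_abs, sq_abs,
        Real.sq_sqrt hh.le] at h5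
      have h7 : ‖inner ℂ e w‖ < 1 := by
        have : ‖1 - inner ℂ e ζ‖ < h := hw2
        rw [h3, sub_add_cancel_left, norm_neg, norm_mul, Complex.norm_real,
          Real.norm_of_nonneg hh.le] at this
        nlinarith
      have h8 : 1 - h ≤ ‖inner ℂ e ζ‖ := by
        have : ‖1 - inner ℂ e ζ‖ < h := hw2
        have h9 := norm_sub_norm_le (1 : ℂ) (inner ℂ e ζ)
        rw [norm_one] at h9
        linarith
      have hζ1 : ‖ζ‖ < 1 := mem_ball_zero_iff.1 hw1
      have hζ2 : ‖ζ‖ ^ 2 < 1 := by nlinarith [norm_nonneg ζ]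
      have h10 : h * ‖w - inner ℂ e w • e‖ ^ 2 ≤ 2 * h := by
        nlinarith [norm_nonneg (inner ℂ e ζ)]
      have h11 : ‖w - inner ℂ e w • e‖ ^ 2 ≤ 2 := by
        by_contra! hcon
        nlinarith
      rw [mem_ball_zero_iff]
      nlinarith [norm_nonneg w, norm_nonneg (inner ℂ e w)]
    · rw [indicator_of_notMem hw]; exact zero_le
  rw [h1, ENNReal.ofReal_inv_of_pos hpos] at h2
  calc volume (unitBall n ∩ cap e h)
      = ENNReal.ofReal (h ^ (n + 1)) *
        ((ENNReal.ofReal (h ^ (n + 1)))⁻¹ * volume (unitBall n ∩ cap e h)) := by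
        rw [← mul_assoc, ENNReal.mul_inv_cancel (by simpa using hpos) ENNReal.ofReal_ne_top,
          one_mul]
    _ ≤ _ := mul_le_mul_right h2 _

/-- The cap lies in the shell of width h of the cone over a spherical cap of measure m, so its
α-measure is ≲ m h^(α+1). For α = 0 that shell lies in a cap of size 5h, whence m h ≲ h^(n+1).
Eliminating m leaves h^(n+1+α), for negative α as well. -/
theorem preMeasure_cap_le_of_le_half {n : ℕ} (hn : 1 ≤ n) {α : ℝ} (hα : -1 < α) :
    ∃ A : ℝ≥0, ∀ e : EuclideanSpace ℂ (Fin n), ‖e‖ = 1 → ∀ h : ℝ, 0 < h → h ≤ 1 / 2 →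
      preMeasure n α (cap e h) ≤ A * ENNReal.ofReal (h ^ ((n : ℝ) + 1 + α)) := by
  obtain ⟨v, hv⟩ : ∃ v : ℝ≥0, (v : ℝ≥0∞) =
      volume (Metric.ball (0 : EuclideanSpace ℂ (Fin n)) 2) :=
    ⟨_, ENNReal.coe_toNNReal measure_ball_lt_top.ne⟩
  have hα1 : 0 < α + 1 := by linarith
  set c : ℝ := 4 ^ |α| / (α + 1) * 2 ^ (2 * n - 1) * 5 ^ (n + 1) with hc
  refine ⟨c.toNNReal * v, fun e he h hh hh2 => ?_⟩
  have hS := measurableSet_cap e (4 * h)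
  set K := {z : EuclideanSpace ℂ (Fin n) | ‖z‖⁻¹ • z ∈ cap e (4 * h)} with hK
  set m := (volume : Measure (EuclideanSpace ℂ (Fin n))).toSphere ((↑) ⁻¹' cap e (4 * h)) with hm
  set X : ℝ := h ^ α * (4 ^ |α| / (α + 1) * 2 ^ (2 * n - 1)) with hX
  have hX0 : 0 ≤ X := by positivity
  have hinner : ∀ z : EuclideanSpace ℂ (Fin n), z ≠ 0 →
      ‖z‖ * ‖1 - inner ℂ e (‖z‖⁻¹ • z)‖ = ‖(‖z‖ : ℂ) - inner ℂ e z‖ := fun z hz => by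
    have hz' : (‖z‖ : ℂ) ≠ 0 := by exact_mod_cast (norm_pos_iff.2 hz).ne'
    have h1 : ‖(‖z‖ : ℂ)‖ = ‖z‖ := by simp
    rw [show (‖z‖⁻¹ • z : EuclideanSpace ℂ (Fin n)) = ((‖z‖ : ℂ)⁻¹) • z by
      rw [← Complex.ofReal_inv, Complex.coe_smul], inner_smul_right]
    nth_rewrite 1 [← h1]
    rw [← norm_mul, mul_sub, mul_one, mul_inv_cancel_left₀ hz']
  have step1 : preMeasure n α (cap e h) ≤
      ∫⁻ z, K.indicator (fun z => shellWeight α h ‖z‖) z := by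
    rw [preMeasure_eq_lintegral _ _ _ (measurableSet_cap e h)]
    refine lintegral_mono fun z => ?_
    by_cases hz : z ∈ unitBall n ∩ cap e h
    · obtain ⟨hz1, hz2⟩ := hz
      rw [mem_ball_zero_iff] at hz1
      have hz3 : ‖1 - inner ℂ e z‖ < h := hz2
      have h3 : ‖inner ℂ e z‖ ≤ ‖z‖ := by
        have := norm_inner_le_norm (𝕜 := ℂ) e z
        rwa [he, one_mul] at this
      have h4 := norm_sub_norm_le (1 : ℂ) (inner ℂ e z)
      rw [norm_one] at h4
      have h5 : 1 - h < ‖z‖ := by linarith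
      have hz0 : z ≠ 0 := by rintro rfl; rw [norm_zero] at h5; linarith
      have hzp := norm_pos_iff.2 hz0
      -- Projecting to the sphere divides by |z| > 1 - h ≥ 1/2, so the bound 2h becomes 4h.
      have hzK : z ∈ K := by
        change ‖1 - inner ℂ e (‖z‖⁻¹ • z)‖ < 4 * h
        have h6 : ‖(‖z‖ : ℂ) - inner ℂ e z‖ < 2 * h := by
          have h7 : ((‖z‖ : ℂ) - inner ℂ e z) = ((‖z‖ - 1 : ℝ) : ℂ) + (1 - inner ℂ e z) := by
            push_cast; ring
          rw [h7]
          refine (norm_add_le _ _).trans_lt ?_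
          rw [Complex.norm_real, Real.norm_eq_abs, abs_of_neg (by linarith)]
          linarith
        rw [← hinner z hz0] at h6
        nlinarith [norm_nonneg (1 - inner ℂ e (‖z‖⁻¹ • z))]
      rw [indicator_of_mem (show z ∈ unitBall n ∩ cap e h from ⟨mem_ball_zero_iff.2 hz1, hz2⟩),
        indicator_of_mem hzK, shellWeight, indicator_of_mem (show ‖z‖ ∈ Ioo (1 - h) 1 from ⟨h5, hz1⟩)]
    · rw [indicator_of_notMem hz]; exact zero_le
  have step2 : ∫⁻ z, K.indicator (fun z => shellWeight 0 h ‖z‖) z ≤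
      volume (unitBall n ∩ cap e (5 * h)) := by
    rw [← lintegral_indicator_one
      (Metric.isOpen_ball.measurableSet.inter (measurableSet_cap e (5 * h)))]
    refine lintegral_mono fun z => ?_
    by_cases hzK : z ∈ K
    · rw [indicator_of_mem hzK, shellWeight]
      by_cases hz : ‖z‖ ∈ Ioo (1 - h) 1
      · rw [indicator_of_mem hz, indicator_of_mem]
        · simp
        obtain ⟨h5, h6⟩ := hz
        have hz0 : z ≠ 0 := by rintro rfl; rw [norm_zero] at h5; linarith
        have hzp := norm_pos_iff.2 hz0
        refine ⟨mem_ball_zero_iff.2 h6, ?_⟩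
        change ‖1 - inner ℂ e z‖ < 5 * h
        have hzK' : ‖1 - inner ℂ e (‖z‖⁻¹ • z)‖ < 4 * h := hzK
        have h8 : ‖(‖z‖ : ℂ) - inner ℂ e z‖ < 4 * h := by
          rw [← hinner z hz0]
          nlinarith [norm_nonneg (1 - inner ℂ e (‖z‖⁻¹ • z))]
        have h7 : (1 - inner ℂ e z) = ((1 - ‖z‖ : ℝ) : ℂ) + (‖z‖ - inner ℂ e z) := by
          push_cast; ring
        rw [h7]
        refine (norm_add_le _ _).trans_lt ?_
        rw [Complex.norm_real, Real.norm_eq_abs, abs_of_pos (by linarith)]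
        linarith
      · rw [indicator_of_notMem hz]; exact zero_le
    · rw [indicator_of_notMem hzK]; exact zero_le
  rw [hK, lintegral_cone hn hS (measurable_shellWeight _ _), ← hm] at step1 step2
  calc preMeasure n α (cap e h)
      ≤ m * ENNReal.ofReal (4 ^ |α| * (h ^ (α + 1) / (α + 1))) :=
        step1.trans (mul_le_mul_right
          (lintegral_shellWeight_le hα hh (hh2.trans (by norm_num)) _) _)
    _ = ENNReal.ofReal X * (m * ENNReal.ofReal ((1 / 2) ^ (2 * n - 1) * h)) := by
        rw [mul_left_comm, ← ENNReal.ofReal_mul hX0, hX]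
        congr 2
        rw [Real.rpow_add hh, Real.rpow_one, one_div, inv_pow]
        field_simp
    _ ≤ ENNReal.ofReal X * volume (unitBall n ∩ cap e (5 * h)) := by
        refine mul_le_mul_right (le_trans ?_ step2) _
        exact mul_le_mul_right (le_lintegral_shellWeight_zero hh2 _) _
    _ ≤ ENNReal.ofReal X * (ENNReal.ofReal ((5 * h) ^ (n + 1)) * v) := by
        rw [hv]
        exact mul_le_mul_right (volume_cap_le he (by positivity)) _
    _ = _ := by
        have hid : X * (5 * h) ^ (n + 1) = c * h ^ ((n : ℝ) + 1 + α) := by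
          have : h ^ ((n : ℝ) + 1) = h ^ (n + 1) := by
            rw [← Real.rpow_natCast]; push_cast; rfl
          rw [hX, hc, mul_pow, Real.rpow_add hh, this]
          ring
        rw [← mul_assoc, ← ENNReal.ofReal_mul hX0, hid, ENNReal.ofReal_mul (by positivity),
          ENNReal.coe_mul, mul_right_comm]
        rfl

/-- The `α`-measure of a nonisotropic cap. -/
theorem exists_preMeasure_cap_le {n : ℕ} (hn : 1 ≤ n) {α : ℝ} (hα : -1 < α) :
    ∃ A : ℝ≥0, ∀ e : EuclideanSpace ℂ (Fin n), ‖e‖ = 1 → ∀ h : ℝ, 0 < h →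
      preMeasure n α (cap e h) ≤ A * ENNReal.ofReal (h ^ ((n : ℝ) + 1 + α)) := by
  obtain ⟨A, hA⟩ := preMeasure_cap_le_of_le_half hn hα
  obtain ⟨v, hv⟩ : ∃ v : ℝ≥0, (v : ℝ≥0∞) = preMeasure n α univ :=
    ⟨_, ENNReal.coe_toNNReal (preMeasure_univ_lt_top hn hα).ne⟩
  have hn0 : (0 : ℝ) ≤ n := n.cast_nonneg
  have hs : 0 < (n : ℝ) + 1 + α := by linarith
  refine ⟨max A (v * 2 ^ ((n : ℝ) + 1 + α)), fun e he h hh => ?_⟩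
  rcases le_total h (1 / 2) with h2 | h2
  · refine (hA e he h hh h2).trans ?_
    gcongr
    exact le_max_left _ _
  -- A large cap is bounded by the total mass, because (2h)^(n+1+α) ≥ 1.
  · calc preMeasure n α (cap e h) ≤ v := by rw [hv]; exact measure_mono (subset_univ _)
      _ ≤ v * ENNReal.ofReal ((2 * h) ^ ((n : ℝ) + 1 + α)) := by
          refine le_mul_of_one_le_right' (ENNReal.one_le_ofReal.2 ?_)
          exact Real.one_le_rpow (by linarith) hs.le
      _ = ((v * 2 ^ ((n : ℝ) + 1 + α) : ℝ≥0) : ℝ≥0∞) *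
            ENNReal.ofReal (h ^ ((n : ℝ) + 1 + α)) := by
          rw [Real.mul_rpow (by norm_num) hh.le, ENNReal.ofReal_mul (by positivity),
            ENNReal.coe_mul, mul_assoc]
          congr 2
          rw [ENNReal.ofReal, Real.toNNReal_rpow_of_nonneg (by norm_num)]
          norm_num
      _ ≤ _ := by
          gcongr
          exact le_max_right _ _

/-! ### Integrals of powers of the kernel -/

theorem ae_mem_unitBall (n : ℕ) (α : ℝ) : ∀ᵐ z ∂(preMeasure n α), z ∈ unitBall n :=
  (withDensity_absolutelyContinuous _ _).ae_le
    (ae_restrict_mem Metric.isOpen_ball.measurableSet)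

theorem one_sub_norm_le_norm_one_sub_inner {n : ℕ} {a z : EuclideanSpace ℂ (Fin n)}
    (hz : z ∈ unitBall n) : 1 - ‖a‖ ≤ ‖1 - inner ℂ a z‖ := by
  have h1 := norm_sub_norm_le (1 : ℂ) (inner ℂ a z)
  have h2 := norm_inner_le_norm (𝕜 := ℂ) a z
  rw [norm_one] at h1
  nlinarith [mem_ball_zero_iff.1 hz, norm_nonneg a, norm_nonneg z]

theorem rpow_pow_comm {x : ℝ} (hx : 0 ≤ x) (s : ℝ) (j : ℕ) : (x ^ s) ^ j = (x ^ j) ^ s := by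
  rw [← Real.rpow_natCast, ← Real.rpow_natCast, ← Real.rpow_mul hx, ← Real.rpow_mul hx, mul_comm]

/-- One term is enough: the j with 2^j ≤ |1-⟨a,z⟩|/(1-|a|) < 2^(j+1). Replacing a by e costs at most
1-|a|, so z lies in the cap of size 3·2^j(1-|a|). -/
theorem kernel_rpow_le_tsum {n : ℕ} {a e z : EuclideanSpace ℂ (Fin n)} (he : ‖e‖ = 1)
    (ha : a ∈ unitBall n) (hae : a = (‖a‖ : ℂ) • e) (hz : z ∈ unitBall n) {M : ℝ} (hM : 0 ≤ M) :
    ENNReal.ofReal (((1 - ‖a‖) / ‖1 - inner ℂ a z‖) ^ M) ≤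
      ∑' j : ℕ, ENNReal.ofReal ((2 ^ (-M)) ^ j) *
        (cap e (2 ^ j * (4 * (1 - ‖a‖)))).indicator 1 z := by
  have hδ := one_sub_norm_pos ha
  have hle := one_sub_norm_le_norm_one_sub_inner (a := a) hz
  set δ := 1 - ‖a‖ with hδ'
  set y := ‖1 - inner ℂ a z‖ with hy
  obtain ⟨j, hj1, hj2⟩ := exists_nat_pow_near (x := y / δ) (y := 2)
    ((one_le_div hδ).2 hle) one_lt_two
  have hmem : z ∈ cap e (2 ^ j * (4 * δ)) := by
    change ‖1 - inner ℂ e z‖ < _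
    have h1 : 1 - inner ℂ e z = (1 - inner ℂ a z) - (δ : ℂ) * inner ℂ e z := by
      have h2 : inner ℂ a z = (‖a‖ : ℂ) * inner ℂ e z := by
        conv_lhs => rw [hae]
        rw [inner_smul_left, Complex.conj_ofReal]
      rw [h2, hδ']
      push_cast
      ring
    have h2 : ‖(δ : ℂ) * inner ℂ e z‖ ≤ δ := by
      rw [norm_mul, Complex.norm_real, Real.norm_of_nonneg hδ.le]
      have h3 := norm_inner_le_norm (𝕜 := ℂ) e z
      rw [he, one_mul] at h3
      nlinarith [mem_ball_zero_iff.1 hz]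
    rw [div_lt_iff₀ hδ, pow_succ] at hj2
    have h4 : (1 : ℝ) ≤ 2 ^ j := one_le_pow₀ one_le_two
    rw [h1]
    refine (norm_sub_le _ _).trans_lt ?_
    nlinarith
  refine le_trans ?_ (ENNReal.le_tsum j)
  rw [indicator_of_mem hmem, Pi.one_apply, mul_one]
  refine ENNReal.ofReal_le_ofReal ?_
  have hy0 : 0 < y := hδ.trans_le hle
  have h5 : δ / y ≤ (2 ^ j)⁻¹ := by
    rw [← inv_div]
    exact inv_anti₀ (by positivity) hj1
  calc (δ / y) ^ M ≤ ((2 ^ j)⁻¹) ^ M := Real.rpow_le_rpow (by positivity) h5 hM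
    _ = (2 ^ (-M)) ^ j := by
      rw [Real.inv_rpow (by positivity), Real.rpow_neg (by norm_num), inv_pow,
        rpow_pow_comm zero_le_two]

/-- Integrating the dyadic sum with the cap estimate gives a geometric series of ratio 2^(n+1+α-M),
convergent by the choice of M. -/
theorem exists_lintegral_kernel_le {n : ℕ} (hn : 1 ≤ n) {α : ℝ} (hα : -1 < α) {M : ℝ}
    (hM : (n : ℝ) + 1 + α < M) :
    ∃ A : ℝ≥0, ∀ a ∈ unitBall n,
      ∫⁻ z, ENNReal.ofReal (((1 - ‖a‖) / ‖1 - inner ℂ a z‖) ^ M) ∂(preMeasure n α) ≤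
        A * ENNReal.ofReal ((1 - ‖a‖) ^ ((n : ℝ) + 1 + α)) := by
  obtain ⟨A, hA⟩ := exists_preMeasure_cap_le hn hα
  have hn0 : (0 : ℝ) ≤ n := n.cast_nonneg
  set s := (n : ℝ) + 1 + α with hs
  have hs0 : 0 < s := by linarith
  set r : ℝ := 2 ^ (s - M) with hr
  have hr1 : r < 1 := Real.rpow_lt_one_of_one_lt_of_neg one_lt_two (by linarith)
  have hr0 : 0 < r := by positivity
  obtain ⟨B, hB⟩ : ∃ B : ℝ≥0, (B : ℝ≥0∞) = A * ENNReal.ofReal (4 ^ s) * (1 - ENNReal.ofReal r)⁻¹ := by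
    refine ⟨_, ENNReal.coe_toNNReal (ENNReal.mul_ne_top (ENNReal.mul_ne_top ENNReal.coe_ne_top
      ENNReal.ofReal_ne_top) (ENNReal.inv_ne_top.2 ?_))⟩
    exact (tsub_pos_of_lt (ENNReal.ofReal_lt_one.2 hr1)).ne'
  refine ⟨B, fun a ha => ?_⟩
  obtain ⟨e, he, hae⟩ := exists_unit_smul hn a
  have hδ := one_sub_norm_pos ha
  calc ∫⁻ z, ENNReal.ofReal (((1 - ‖a‖) / ‖1 - inner ℂ a z‖) ^ M) ∂(preMeasure n α)
      ≤ ∫⁻ z, ∑' j : ℕ, ENNReal.ofReal ((2 ^ (-M)) ^ j) *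
        (cap e (2 ^ j * (4 * (1 - ‖a‖)))).indicator 1 z ∂(preMeasure n α) := by
        refine lintegral_mono_ae ?_
        filter_upwards [ae_mem_unitBall n α] with z hz
        exact kernel_rpow_le_tsum he ha hae hz (hs0.trans hM).le
    _ = ∑' j : ℕ, ENNReal.ofReal ((2 ^ (-M)) ^ j) *
          preMeasure n α (cap e (2 ^ j * (4 * (1 - ‖a‖)))) := by
        rw [lintegral_tsum fun j => ((measurable_one.indicator
          (measurableSet_cap _ _)).const_mul _).aemeasurable]
        refine tsum_congr fun j => ?_
        rw [lintegral_const_mul' _ _ ENNReal.ofReal_ne_top,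
          lintegral_indicator_one (measurableSet_cap _ _)]
    _ ≤ ∑' j : ℕ, A * ENNReal.ofReal (4 ^ s) * ENNReal.ofReal ((1 - ‖a‖) ^ s) *
          ENNReal.ofReal r ^ j := by
        refine ENNReal.tsum_le_tsum fun j => ?_
        refine (mul_le_mul_right (hA e he _ (by positivity)) _).trans_eq ?_
        rw [Real.mul_rpow (by positivity) (by positivity), Real.mul_rpow (by positivity) hδ.le,
          ENNReal.ofReal_mul (by positivity), ENNReal.ofReal_mul (by positivity),
          ← ENNReal.ofReal_pow hr0.le]
        have h1 : r ^ j = (2 ^ (-M)) ^ j * (2 ^ j) ^ s := by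
          rw [hr, sub_eq_neg_add, Real.rpow_add two_pos, mul_pow]
          rw [rpow_pow_comm zero_le_two s]
        rw [h1, ENNReal.ofReal_mul (by positivity)]
        ring
    _ = B * ENNReal.ofReal ((1 - ‖a‖) ^ s) := by
        rw [ENNReal.tsum_mul_left, ENNReal.tsum_geometric, hB]
        ring

/-! ### The normalized measure -/

theorem preMeasure_univ_pos (n : ℕ) (α : ℝ) : 0 < preMeasure n α univ := by
  rw [preMeasure, withDensity_apply _ MeasurableSet.univ, Measure.restrict_univ,
    setLIntegral_pos_iff (measurable_weight n α)]
  refine (Metric.measure_ball_pos volume (0 : EuclideanSpace ℂ (Fin n)) one_pos).trans_le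
    (measure_mono fun z hz => ⟨?_, hz⟩)
  rw [Function.mem_support]
  have := Real.rpow_pos_of_pos (one_sub_norm_sq_pos hz) α
  simpa using this

theorem exists_lintegral_nuMeasure {n : ℕ} (hn : 1 ≤ n) {α : ℝ} (hα : -1 < α) :
    ∃ c : ℝ≥0, 0 < c ∧ ∀ F : EuclideanSpace ℂ (Fin n) → ℝ≥0∞,
      ∫⁻ z, F z ∂(nuMeasure n α) = c * ∫⁻ z, F z ∂(preMeasure n α) := by
  have h1 := (preMeasure_univ_pos n α).ne'
  have h2 := (preMeasure_univ_lt_top hn hα).ne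
  refine ⟨((preMeasure n α univ)⁻¹).toNNReal, ENNReal.toNNReal_pos (ENNReal.inv_ne_zero.2 h2)
    (ENNReal.inv_ne_top.2 h1), fun F => ?_⟩
  rw [ENNReal.coe_toNNReal (ENNReal.inv_ne_top.2 h1), nuMeasure, lintegral_smul_measure]
  rfl

/-- The reciprocal `1 / (1 - |z|)`. -/
def invDist {n : ℕ} (z : EuclideanSpace ℂ (Fin n)) : ℝ≥0 := 1 / (1 - ‖z‖₊)

theorem coe_invDist {n : ℕ} {z : EuclideanSpace ℂ (Fin n)} (hz : z ∈ unitBall n) :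
    (invDist z : ℝ) = (1 - ‖z‖)⁻¹ := by
  have h : ‖z‖₊ ≤ 1 := (mem_ball_zero_iff.1 hz).le
  rw [invDist, NNReal.coe_div, NNReal.coe_sub h]
  simp

theorem one_le_invDist {n : ℕ} {z : EuclideanSpace ℂ (Fin n)} (hz : z ∈ unitBall n) :
    1 ≤ invDist z := by
  rw [← NNReal.coe_le_coe, coe_invDist hz, NNReal.coe_one]
  exact (one_le_inv₀ (one_sub_norm_pos hz)).2 (by linarith [norm_nonneg z])

theorem coe_invDist_rpow {n : ℕ} {z : EuclideanSpace ℂ (Fin n)} (hz : z ∈ unitBall n) (s : ℝ) :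
    ((invDist z ^ s : ℝ≥0) : ℝ≥0∞) = ENNReal.ofReal ((1 - ‖z‖) ^ (-s)) := by
  rw [ENNReal.ofReal]
  congr 1
  ext
  rw [NNReal.coe_rpow, coe_invDist hz, Real.inv_rpow (one_sub_norm_pos hz).le,
    ← Real.rpow_neg (one_sub_norm_pos hz).le, Real.coe_toNNReal _
    (Real.rpow_nonneg (one_sub_norm_pos hz).le _)]

/-! ### Luxemburg norms -/

section Luxemburg

variable {p q : ℝ} {C : ℝ≥0} {Φ : ℝ≥0 → ℝ≥0}

/-- Any modular bound B becomes the bound 1 after a rescaling that depends only on B and Φ, so norm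
estimates need only modular ones. -/
theorem PowerBounds.exists_lintegral_div_le_one (h : PowerBounds p q C Φ) (n : ℕ) (α : ℝ)
    (B : ℝ≥0) :
    ∃ K : ℝ≥0, 0 < K ∧ ∀ (f : EuclideanSpace ℂ (Fin n) → ℂ) (l : ℝ≥0),
      ∫⁻ z, (Φ (‖f z‖₊ / l) : ℝ≥0∞) ∂(nuMeasure n α) ≤ B →
        ∫⁻ z, (Φ (‖f z‖₊ / (K * l)) : ℝ≥0∞) ∂(nuMeasure n α) ≤ 1 := by
  obtain ⟨K, hK1, hK⟩ := h.exists_mul_map_le (B + 1)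
  refine ⟨K, one_pos.trans_le hK1, fun f l hf => ?_⟩
  have h0 : ((B + 1 : ℝ≥0) : ℝ≥0∞) ≠ 0 := by
    exact_mod_cast (by positivity : (0 : ℝ≥0) < B + 1).ne'
  rw [← ENNReal.mul_le_mul_iff_right h0 ENNReal.coe_ne_top,
    ← lintegral_const_mul' _ _ ENNReal.coe_ne_top, mul_one]
  calc ∫⁻ z, ((B + 1 : ℝ≥0) : ℝ≥0∞) * (Φ (‖f z‖₊ / (K * l)) : ℝ≥0∞) ∂(nuMeasure n α)
      ≤ ∫⁻ z, (Φ (‖f z‖₊ / l) : ℝ≥0∞) ∂(nuMeasure n α) := by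
        refine lintegral_mono fun z => ?_
        rw [mul_comm K l, ← div_div, ← ENNReal.coe_mul]
        exact ENNReal.coe_le_coe.2 (hK _)
    _ ≤ B := hf
    _ ≤ _ := by gcongr; exact le_self_add

theorem luxNorm_le {n : ℕ} {α : ℝ} {f : EuclideanSpace ℂ (Fin n) → ℂ} {l : ℝ≥0} (hl : 0 < l)
    (h : ∫⁻ z, (Φ (‖f z‖₊ / l) : ℝ≥0∞) ∂(nuMeasure n α) ≤ 1) : luxNorm n α Φ f ≤ l :=
  iInf₂_le l ⟨hl, h⟩

/-- A function of the Bergman-Orlicz space is bounded pointwise by its Luxemburg norm times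
`Φ⁻¹((1 - |z|) ^ (-(n + 1 + α)))`. -/
theorem PowerBounds.exists_nnnorm_le (h : PowerBounds p q C Φ) {n : ℕ} (hn : 1 ≤ n) {α : ℝ}
    (hα : -1 < α) :
    ∃ K : ℝ≥0, 0 < K ∧ ∀ f ∈ holo n, ∀ z ∈ unitBall n, ∀ l : ℝ≥0, 0 < l →
      ∫⁻ w, (Φ (‖f w‖₊ / l) : ℝ≥0∞) ∂(nuMeasure n α) ≤ 1 →
        ‖f z‖₊ ≤ K * l * growthInv Φ (invDist z ^ ((n : ℝ) + 1 + α)) := by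
  obtain ⟨A, hA⟩ := h.exists_map_nnnorm_le_preMeasure hn α
  obtain ⟨c, hc, hcF⟩ := exists_lintegral_nuMeasure hn hα
  obtain ⟨K, hK0, hK⟩ := h.exists_le_mul_growthInv (A / c)
  refine ⟨K, hK0, fun f hf z hz l hl hint => ?_⟩
  have hT : 0 < invDist z ^ ((n : ℝ) + 1 + α) :=
    NNReal.rpow_pos (one_pos.trans_le (one_le_invDist hz))
  have hnorm : ∀ w, ‖f w / ((l : ℝ) : ℂ)‖₊ = ‖f w‖₊ / l := fun w => by
    rw [nnnorm_div]; simp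
  have hfl : (fun w => f w / ((l : ℝ) : ℂ)) ∈ holo n := by
    change DifferentiableOn ℂ (fun w => f w / ((l : ℝ) : ℂ)) (unitBall n)
    simp only [div_eq_mul_inv]
    exact DifferentiableOn.mul_const hf _
  have h1 := hA _ hfl z hz
  simp only [hnorm] at h1
  rw [← coe_invDist_rpow hz] at h1
  rw [hcF] at hint
  set I := ∫⁻ w, (Φ (‖f w‖₊ / l) : ℝ≥0∞) ∂(preMeasure n α) with hI
  have h2 : I ≤ ((c⁻¹ : ℝ≥0) : ℝ≥0∞) := by
    calc I = ((c⁻¹ : ℝ≥0) : ℝ≥0∞) * (c * I) := by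
          rw [← mul_assoc, ← ENNReal.coe_mul, inv_mul_cancel₀ hc.ne', ENNReal.coe_one, one_mul]
      _ ≤ ((c⁻¹ : ℝ≥0) : ℝ≥0∞) * 1 := by gcongr
      _ = _ := mul_one _
  have h3 : Φ (‖f z‖₊ / l) ≤ A / c * invDist z ^ ((n : ℝ) + 1 + α) := by
    rw [← ENNReal.coe_le_coe]
    refine h1.trans ((mul_le_mul_right h2 _).trans_eq ?_)
    rw [← ENNReal.coe_mul, ← ENNReal.coe_mul]
    congr 1
    rw [div_eq_mul_inv]; ring
  have h4 := hK _ _ hT h3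
  rw [div_le_iff₀ hl] at h4
  exact h4.trans_eq (by ring)

theorem PowerBounds.exists_admissible (h : PowerBounds p q C Φ) {n : ℕ} {α : ℝ}
    {f : EuclideanSpace ℂ (Fin n) → ℂ} (hf : f ∈ bergmanOrlicz n α Φ) :
    ∃ l : ℝ≥0, 0 < l ∧ ∫⁻ z, (Φ (‖f z‖₊ / l) : ℝ≥0∞) ∂(nuMeasure n α) ≤ 1 := by
  obtain ⟨K, hK0, hK⟩ := h.exists_lintegral_div_le_one n α
    (∫⁻ z, (Φ ‖f z‖₊ : ℝ≥0∞) ∂(nuMeasure n α)).toNNReal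
  refine ⟨K * 1, by simpa using hK0, hK f 1 ?_⟩
  rw [ENNReal.coe_toNNReal hf.2.ne]
  simp

/-- Test functions: they are uniformly bounded in Luxemburg norm, and extremal for the pointwise
estimate at a given point, up to a constant. -/
theorem PowerBounds.exists_test_function (h : PowerBounds p q C Φ) {n : ℕ} (hn : 1 ≤ n) {α : ℝ}
    (hα : -1 < α) :
    ∃ K L : ℝ≥0, 0 < K ∧ 0 < L ∧ ∀ a ∈ unitBall n, ∃ f ∈ bergmanOrlicz n α Φ,
      luxNorm n α Φ f ≤ K ∧ growthInv Φ (invDist a ^ ((n : ℝ) + 1 + α)) ≤ L * ‖f a‖₊ := by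
  set s := (n : ℝ) + 1 + α with hs
  -- Lower type turns the k-th power of the kernel into its kp-th power, integrable with the sharp
  -- bound once kp > n+1+α.
  obtain ⟨k, hk⟩ := exists_nat_gt (s / p)
  rw [div_lt_iff₀ h.lower_pos] at hk
  obtain ⟨A, hA⟩ := exists_lintegral_kernel_le hn hα hk
  obtain ⟨c, hc, hcF⟩ := exists_lintegral_nuMeasure hn hα
  obtain ⟨K, hK0, hK⟩ := h.exists_lintegral_div_le_one n α (c * (C * A))
  refine ⟨K * 1, 2 ^ k, by simpa using hK0, by positivity, fun a ha => ?_⟩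
  have hδ := one_sub_norm_pos ha
  set v := growthInv Φ (invDist a ^ s) with hv
  have hT : 0 < invDist a ^ s := NNReal.rpow_pos (one_pos.trans_le (one_le_invDist ha))
  set f : EuclideanSpace ℂ (Fin n) → ℂ :=
    fun z => ((v : ℝ) : ℂ) * (((1 - ‖a‖ : ℝ) : ℂ) / (1 - inner ℂ a z)) ^ k with hf
  have hne : ∀ z ∈ unitBall n, 1 - inner ℂ a z ≠ 0 := fun z hz => by
    rw [← norm_pos_iff]
    exact hδ.trans_le (one_sub_norm_le_norm_one_sub_inner hz)
  have hholo : f ∈ holo n := by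
    have hd : DifferentiableOn ℂ (fun z => 1 - inner ℂ a z) (unitBall n) :=
      (differentiableOn_const _).sub (innerSL ℂ a).differentiable.differentiableOn
    change DifferentiableOn ℂ f (unitBall n)
    simp only [hf, div_eq_mul_inv]
    exact (((hd.inv hne).const_mul _).pow k).const_mul _
  have hnf : ∀ z ∈ unitBall n, (Φ ‖f z‖₊ : ℝ≥0∞) ≤ (C * invDist a ^ s : ℝ≥0) *
      ENNReal.ofReal (((1 - ‖a‖) / ‖1 - inner ℂ a z‖) ^ (k * p)) := fun z hz => by
    have hx0 : 0 ≤ (1 - ‖a‖) / ‖1 - inner ℂ a z‖ := by positivity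
    set x : ℝ≥0 := ⟨(1 - ‖a‖) / ‖1 - inner ℂ a z‖, hx0⟩ with hx
    have hx1 : x ≤ 1 := by
      rw [← NNReal.coe_le_coe]
      exact (div_le_one (norm_pos_iff.2 (hne z hz))).2 (one_sub_norm_le_norm_one_sub_inner hz)
    have h1 : ‖f z‖₊ = v * x ^ k := by
      ext
      simp only [hf, coe_nnnorm, norm_mul, norm_pow, norm_div, Complex.norm_real, NNReal.coe_mul,
        NNReal.coe_pow, Real.norm_of_nonneg hδ.le, NNReal.norm_eq]
      rfl
    have h2 : ENNReal.ofReal (((1 - ‖a‖) / ‖1 - inner ℂ a z‖) ^ (k * p)) =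
        (((x ^ k) ^ p : ℝ≥0) : ℝ≥0∞) := by
      rw [ENNReal.ofReal]
      congr 1
      ext
      rw [Real.coe_toNNReal _ (by positivity), Real.rpow_mul hx0, Real.rpow_natCast]
      rfl
    rw [h2, ← ENNReal.coe_mul, h1]
    refine ENNReal.coe_le_coe.2 ((h.lower v (x ^ k) (pow_le_one₀ zero_le hx1)).trans_eq ?_)
    rw [hv, h.growth.apply_growthInv]
    ring
  -- Since Φ(v) = (1-|a|)^(-s), it cancels the factor (1-|a|)^s of the kernel estimate, and the
  -- bound does not depend on a.
  have hint : ∫⁻ z, (Φ ‖f z‖₊ : ℝ≥0∞) ∂(nuMeasure n α) ≤ (c * (C * A) : ℝ≥0) := by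
    rw [hcF, ENNReal.coe_mul]
    refine mul_le_mul_right ?_ _
    calc ∫⁻ z, (Φ ‖f z‖₊ : ℝ≥0∞) ∂(preMeasure n α)
        ≤ ∫⁻ z, (C * invDist a ^ s : ℝ≥0) *
            ENNReal.ofReal (((1 - ‖a‖) / ‖1 - inner ℂ a z‖) ^ (k * p)) ∂(preMeasure n α) := by
          refine lintegral_mono_ae ?_
          filter_upwards [ae_mem_unitBall n α] with z hz using hnf z hz
      _ ≤ (C * invDist a ^ s : ℝ≥0) * (A * ENNReal.ofReal ((1 - ‖a‖) ^ s)) := by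
          rw [lintegral_const_mul' _ _ ENNReal.coe_ne_top]
          exact mul_le_mul_right (hA a ha) _
      _ = _ := by
          have h3 := coe_invDist_rpow ha (-s)
          rw [neg_neg] at h3
          rw [← h3, ← ENNReal.coe_mul, ← ENNReal.coe_mul, NNReal.rpow_neg]
          congr 1
          field_simp
  refine ⟨f, ⟨hholo, hint.trans_lt ENNReal.coe_lt_top⟩, ?_, ?_⟩
  · refine luxNorm_le (by simpa using hK0) (hK f 1 ?_)
    simpa using hint
  -- At z = a the kernel equals 1/(1+|a|) ≥ 1/2, whence the constant 2^k.
  · have h1 : ‖f a‖ = v * (1 + ‖a‖)⁻¹ ^ k := by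
      have h2 : (1 : ℂ) - inner ℂ a a = (((1 - ‖a‖) * (1 + ‖a‖) : ℝ) : ℂ) := by
        have h3 : inner ℂ a a = (‖a‖ : ℂ) ^ 2 := inner_self_eq_norm_sq_to_K a
        rw [h3]; push_cast; ring
      have h3 : 0 < 1 + ‖a‖ := by positivity
      simp only [hf]
      rw [h2, norm_mul, norm_pow, norm_div, Complex.norm_real, Complex.norm_real,
        Complex.norm_real, NNReal.norm_eq, Real.norm_of_nonneg hδ.le,
        Real.norm_of_nonneg (by positivity)]
      congr 2
      field_simp
    rw [← NNReal.coe_le_coe, NNReal.coe_mul, coe_nnnorm, h1]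
    have h4 : (1 : ℝ) ≤ 2 ^ k * (1 + ‖a‖)⁻¹ ^ k := by
      rw [← mul_pow]
      refine one_le_pow₀ ?_
      rw [← div_eq_mul_inv, one_le_div (by positivity)]
      linarith [mem_ball_zero_iff.1 ha]
    push_cast
    nlinarith [v.coe_nonneg]

end Luxemburg

/-! ### Multipliers -/

section Multipliers

variable {p₁ q₁ p₂ q₂ : ℝ} {C₁ C₂ : ℝ≥0} {Φ₁ Φ₂ : ℝ≥0 → ℝ≥0} {n : ℕ} {α β : ℝ}

theorem gammaFun_pos (h₁ : PowerBounds p₁ q₁ C₁ Φ₁) (h₂ : PowerBounds p₂ q₂ C₂ Φ₂) {t : ℝ≥0}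
    (ht : 1 ≤ t) : 0 < gammaFun n α β Φ₁ Φ₂ t :=
  div_pos (h₂.growthInv_pos (NNReal.rpow_pos (one_pos.trans_le ht)))
    (h₁.growthInv_pos (NNReal.rpow_pos (one_pos.trans_le ht)))

/-- A multiplier is bounded by a multiple of `γ(1 / (1 - |z|))`. -/
theorem exists_nnnorm_le_of_mem_multipliers (h₁ : PowerBounds p₁ q₁ C₁ Φ₁)
    (h₂ : PowerBounds p₂ q₂ C₂ Φ₂) (hn : 1 ≤ n) (hα : -1 < α) (hβ : -1 < β)
    {g : EuclideanSpace ℂ (Fin n) → ℂ} (hg : g ∈ multipliers n α β Φ₁ Φ₂) :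
    ∃ K : ℝ≥0, ∀ z ∈ unitBall n, ‖g z‖₊ ≤ K * gammaFun n α β Φ₁ Φ₂ (invDist z) := by
  obtain ⟨-, C, hC, hmul⟩ := hg
  obtain ⟨K, L, hK, hL, htest⟩ := h₁.exists_test_function hn hα
  obtain ⟨M, hM, hpt⟩ := h₂.exists_nnnorm_le hn hβ
  refine ⟨M * (C * K + 1) * L, fun a ha => ?_⟩
  obtain ⟨f, hf, hfK, hfa⟩ := htest a ha
  obtain ⟨hfg, hlux⟩ := hmul f hf
  -- The added 1 gives a strict inequality, from which an actual admissible l below the bound can be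
  -- extracted.
  have h3 : luxNorm n β Φ₂ (fun z => f z * g z) < ((C * K + 1 : ℝ≥0) : ℝ≥0∞) := by
    calc luxNorm n β Φ₂ (fun z => f z * g z) ≤ C * luxNorm n α Φ₁ f := hlux
      _ ≤ C * K := by gcongr
      _ = ((C * K : ℝ≥0) : ℝ≥0∞) := (ENNReal.coe_mul _ _).symm
      _ < _ := ENNReal.coe_lt_coe.2 (lt_add_one _)
  rw [luxNorm] at h3
  simp only [iInf_lt_iff] at h3
  obtain ⟨l, ⟨hl, hint⟩, hlK⟩ := h3
  have h4 := hpt _ hfg.1 a ha l hl hint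
  rw [nnnorm_mul] at h4
  have hT : 0 < invDist a := one_pos.trans_le (one_le_invDist ha)
  set v := growthInv Φ₁ (invDist a ^ ((n : ℝ) + 1 + α)) with hv
  set V := growthInv Φ₂ (invDist a ^ ((n : ℝ) + 1 + β)) with hV
  have hv0 : 0 < v := h₁.growthInv_pos (NNReal.rpow_pos hT)
  change ‖g a‖₊ ≤ _ * (V / v)
  rw [← mul_div_assoc, le_div_iff₀ hv0]
  calc ‖g a‖₊ * v ≤ ‖g a‖₊ * (L * ‖f a‖₊) := by gcongr
    _ = L * (‖f a‖₊ * ‖g a‖₊) := by ring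
    _ ≤ L * (M * l * V) := by gcongr
    _ ≤ L * (M * (C * K + 1) * V) := by
        gcongr
        exact (ENNReal.coe_lt_coe.1 hlK).le
    _ = _ := by ring

/-- Because 1-|z| and 1-|z|² are comparable, the factor t^(β-α) exchanges one weight for the other.
-/
theorem weight_mul_invDist_le {z : EuclideanSpace ℂ (Fin n)} (hz : z ∈ unitBall n) :
    ENNReal.ofReal ((1 - ‖z‖ ^ 2) ^ β) * ((invDist z ^ (β - α) : ℝ≥0) : ℝ≥0∞) ≤
      ENNReal.ofReal (4 ^ |α - β|) * ENNReal.ofReal ((1 - ‖z‖ ^ 2) ^ α) := by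
  have hx := one_sub_norm_pos hz
  have hy := one_sub_norm_sq_pos hz
  have hz0 := norm_nonneg z
  rw [coe_invDist_rpow hz, ← ENNReal.ofReal_mul (by positivity),
    ← ENNReal.ofReal_mul (by positivity), neg_sub]
  refine ENNReal.ofReal_le_ofReal ?_
  have := rpow_le_of_comparable hx hy (by nlinarith) (by nlinarith) (α - β)
  calc (1 - ‖z‖ ^ 2) ^ β * (1 - ‖z‖) ^ (α - β)
      ≤ (1 - ‖z‖ ^ 2) ^ β * (4 ^ |α - β| * (1 - ‖z‖ ^ 2) ^ (α - β)) := by gcongr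
    _ = 4 ^ |α - β| * ((1 - ‖z‖ ^ 2) ^ β * (1 - ‖z‖ ^ 2) ^ (α - β)) := by ring
    _ = _ := by rw [← Real.rpow_add hy, add_sub_cancel]

/-- If `Φ₂(u γ(t)) ≲ Φ₁(u) t ^ (β - α)` for `u ≤ Φ₁⁻¹(t ^ (n + 1 + α))`, then every holomorphic
function bounded by a multiple of `γ(1 / (1 - |z|))` is a multiplier. -/
theorem mem_multipliers_of_transfer (h₁ : PowerBounds p₁ q₁ C₁ Φ₁)
    (h₂ : PowerBounds p₂ q₂ C₂ Φ₂) (hn : 1 ≤ n) (hα : -1 < α) (hβ : -1 < β) {A : ℝ≥0}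
    (hA : ∀ t u : ℝ≥0, 1 ≤ t → u ≤ growthInv Φ₁ (t ^ ((n : ℝ) + 1 + α)) →
      Φ₂ (u * gammaFun n α β Φ₁ Φ₂ t) * t ^ ((n : ℝ) + 1 + α) ≤
        A * Φ₁ u * t ^ ((n : ℝ) + 1 + β))
    {g : EuclideanSpace ℂ (Fin n) → ℂ} (hg : g ∈ holo n) {K : ℝ≥0}
    (hK : ∀ z ∈ unitBall n, ‖g z‖₊ ≤ K * gammaFun n α β Φ₁ Φ₂ (invDist z)) :
    g ∈ multipliers n α β Φ₁ Φ₂ := by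
  obtain ⟨M, hM, hpt⟩ := h₁.exists_nnnorm_le hn hα
  obtain ⟨A₂, -, hA₂⟩ := h₂.exists_map_mul_le (M * K)
  obtain ⟨A₁, -, hA₁⟩ := h₁.exists_map_mul_le M⁻¹
  obtain ⟨c₁, hc₁, hν₁⟩ := exists_lintegral_nuMeasure hn hα
  obtain ⟨c₂, hc₂, hν₂⟩ := exists_lintegral_nuMeasure hn hβ
  set D : ℝ≥0 := A₂ * A * A₁ with hD
  set B : ℝ≥0 := c₂ * (D * ((4 : ℝ) ^ |α - β|).toNNReal * c₁⁻¹) with hB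
  obtain ⟨R, hR, hlux⟩ := h₂.exists_lintegral_div_le_one n β B
  have key : ∀ f ∈ holo n, ∀ l : ℝ≥0, 0 < l →
      ∫⁻ w, (Φ₁ (‖f w‖₊ / l) : ℝ≥0∞) ∂(nuMeasure n α) ≤ 1 →
        ∫⁻ w, (Φ₂ (‖f w * g w‖₊ / l) : ℝ≥0∞) ∂(nuMeasure n β) ≤ B := by
    intro f hf l hl hint
    have hpoint : ∀ z ∈ unitBall n, Φ₂ (‖f z * g z‖₊ / l) ≤
        D * invDist z ^ (β - α) * Φ₁ (‖f z‖₊ / l) := by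
      intro z hz
      have hT1 := one_le_invDist hz
      have hT : 0 < invDist z := one_pos.trans_le hT1
      -- Dividing by the constant of the pointwise estimate brings u under v, where the transfer
      -- inequality applies; doubling restores the constants afterwards.
      set u := M⁻¹ * (‖f z‖₊ / l) with hu
      have huv : u ≤ growthInv Φ₁ (invDist z ^ ((n : ℝ) + 1 + α)) := by
        have := hpt f hf z hz l hl hint
        rw [hu, inv_mul_le_iff₀ hM, div_le_iff₀ hl]
        exact this.trans_eq (by ring)
      have h3 := hA _ _ hT1 huv
      have h4 : Φ₂ (u * gammaFun n α β Φ₁ Φ₂ (invDist z)) ≤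
          A * Φ₁ u * invDist z ^ (β - α) := by
        have h5 : invDist z ^ ((n : ℝ) + 1 + β) =
            invDist z ^ (β - α) * invDist z ^ ((n : ℝ) + 1 + α) := by
          rw [← NNReal.rpow_add hT.ne']; congr 1; ring
        rw [h5, ← mul_assoc] at h3
        exact le_of_mul_le_mul_right h3 (NNReal.rpow_pos hT)
      calc Φ₂ (‖f z * g z‖₊ / l)
          ≤ Φ₂ (M * K * (u * gammaFun n α β Φ₁ Φ₂ (invDist z))) := by
            refine h₂.growth.monotone ?_
            rw [nnnorm_mul]
            calc ‖f z‖₊ * ‖g z‖₊ / l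
                ≤ ‖f z‖₊ * (K * gammaFun n α β Φ₁ Φ₂ (invDist z)) / l := by
                  gcongr; exact hK z hz
              _ = _ := by rw [hu]; field_simp
        _ ≤ A₂ * Φ₂ (u * gammaFun n α β Φ₁ Φ₂ (invDist z)) := hA₂ _
        _ ≤ A₂ * (A * Φ₁ u * invDist z ^ (β - α)) := by gcongr
        _ ≤ A₂ * (A * (A₁ * Φ₁ (‖f z‖₊ / l)) * invDist z ^ (β - α)) := by
            gcongr; exact hA₁ _
        _ = _ := by rw [hD]; ring
    have hint' : ∫⁻ w, (Φ₁ (‖f w‖₊ / l) : ℝ≥0∞) ∂(preMeasure n α) ≤ ((c₁⁻¹ : ℝ≥0) : ℝ≥0∞) := by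
      rw [hν₁] at hint
      calc ∫⁻ w, (Φ₁ (‖f w‖₊ / l) : ℝ≥0∞) ∂(preMeasure n α)
          = ((c₁⁻¹ : ℝ≥0) : ℝ≥0∞) *
              (c₁ * ∫⁻ w, (Φ₁ (‖f w‖₊ / l) : ℝ≥0∞) ∂(preMeasure n α)) := by
            rw [← mul_assoc, ← ENNReal.coe_mul, inv_mul_cancel₀ hc₁.ne', ENNReal.coe_one, one_mul]
        _ ≤ ((c₁⁻¹ : ℝ≥0) : ℝ≥0∞) * 1 := mul_le_mul_right hint _
        _ = _ := mul_one _
    rw [hν₂, hB, ENNReal.coe_mul]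
    refine mul_le_mul_right ?_ _
    calc ∫⁻ w, (Φ₂ (‖f w * g w‖₊ / l) : ℝ≥0∞) ∂(preMeasure n β)
        = ∫⁻ w in unitBall n, ENNReal.ofReal ((1 - ‖w‖ ^ 2) ^ β) *
            (Φ₂ (‖f w * g w‖₊ / l) : ℝ≥0∞) := lintegral_preMeasure _ _ _
      _ ≤ ∫⁻ w in unitBall n, ((D * ((4 : ℝ) ^ |α - β|).toNNReal : ℝ≥0) : ℝ≥0∞) *
            (ENNReal.ofReal ((1 - ‖w‖ ^ 2) ^ α) * (Φ₁ (‖f w‖₊ / l) : ℝ≥0∞)) := by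
          refine setLIntegral_mono' Metric.isOpen_ball.measurableSet fun w hw => ?_
          calc ENNReal.ofReal ((1 - ‖w‖ ^ 2) ^ β) * (Φ₂ (‖f w * g w‖₊ / l) : ℝ≥0∞)
              ≤ ENNReal.ofReal ((1 - ‖w‖ ^ 2) ^ β) *
                ((D * invDist w ^ (β - α) * Φ₁ (‖f w‖₊ / l) : ℝ≥0) : ℝ≥0∞) := by
                gcongr; exact hpoint w hw
            _ = D * (ENNReal.ofReal ((1 - ‖w‖ ^ 2) ^ β) *
                  ((invDist w ^ (β - α) : ℝ≥0) : ℝ≥0∞)) * (Φ₁ (‖f w‖₊ / l) : ℝ≥0∞) := by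
                rw [ENNReal.coe_mul, ENNReal.coe_mul]; ring
            _ ≤ D * (ENNReal.ofReal (4 ^ |α - β|) * ENNReal.ofReal ((1 - ‖w‖ ^ 2) ^ α)) *
                  (Φ₁ (‖f w‖₊ / l) : ℝ≥0∞) := by
                exact mul_le_mul_left (mul_le_mul_right (weight_mul_invDist_le hw) _) _
            _ = _ := by
                rw [ENNReal.coe_mul D, ENNReal.ofReal]; ring
      _ = ((D * ((4 : ℝ) ^ |α - β|).toNNReal : ℝ≥0) : ℝ≥0∞) *
            ∫⁻ w, (Φ₁ (‖f w‖₊ / l) : ℝ≥0∞) ∂(preMeasure n α) := by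
          rw [lintegral_const_mul' _ _ ENNReal.coe_ne_top, lintegral_preMeasure]
      _ ≤ _ := by
          rw [ENNReal.coe_mul (D * _)]
          exact mul_le_mul_right hint' _
  refine ⟨hg, R, hR, fun f hf => ⟨⟨DifferentiableOn.mul hf.1 hg, ?_⟩, ?_⟩⟩
  · obtain ⟨l, hl, hint⟩ := h₁.exists_admissible hf
    obtain ⟨A₃, -, hA₃⟩ := h₂.exists_map_mul_le l
    calc ∫⁻ z, (Φ₂ ‖f z * g z‖₊ : ℝ≥0∞) ∂(nuMeasure n β)
        ≤ ∫⁻ z, A₃ * (Φ₂ (‖f z * g z‖₊ / l) : ℝ≥0∞) ∂(nuMeasure n β) := by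
          refine lintegral_mono fun z => ?_
          rw [← ENNReal.coe_mul]
          refine ENNReal.coe_le_coe.2 ?_
          have := hA₃ (‖f z * g z‖₊ / l)
          rwa [mul_div_cancel₀ _ hl.ne'] at this
      _ = A₃ * ∫⁻ z, (Φ₂ (‖f z * g z‖₊ / l) : ℝ≥0∞) ∂(nuMeasure n β) :=
          lintegral_const_mul' _ _ ENNReal.coe_ne_top
      _ ≤ A₃ * B := mul_le_mul_right (key f hf.1 l hl hint) _
      _ < ∞ := ENNReal.mul_lt_top ENNReal.coe_lt_top ENNReal.coe_lt_top
  · have hR0 : (R : ℝ≥0∞) ≠ 0 := by exact_mod_cast hR.ne'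
    -- Moving R to the left isolates the infimum that defines the norm of f, so each admissible l
    -- can be treated separately.
    rw [mul_comm, ← ENNReal.div_le_iff hR0 ENNReal.coe_ne_top]
    refine le_iInf₂ fun l hl => ?_
    rw [ENNReal.div_le_iff hR0 ENNReal.coe_ne_top, mul_comm, ← ENNReal.coe_mul]
    exact luxNorm_le (mul_pos hR hl.1) (hlux _ l (key f hf.1 l hl.1 hl.2))

theorem multipliers_eq_weightedHInf_of_transfer (h₁ : PowerBounds p₁ q₁ C₁ Φ₁)
    (h₂ : PowerBounds p₂ q₂ C₂ Φ₂) (hn : 1 ≤ n) (hα : -1 < α) (hβ : -1 < β) {A : ℝ≥0}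
    (hA : ∀ t u : ℝ≥0, 1 ≤ t → u ≤ growthInv Φ₁ (t ^ ((n : ℝ) + 1 + α)) →
      Φ₂ (u * gammaFun n α β Φ₁ Φ₂ t) * t ^ ((n : ℝ) + 1 + α) ≤
        A * Φ₁ u * t ^ ((n : ℝ) + 1 + β)) :
    multipliers n α β Φ₁ Φ₂ = weightedHInf n (fun s => gammaFun n α β Φ₁ Φ₂ (1 / s)) := by
  ext g
  constructor
  · intro hg
    obtain ⟨K, hK⟩ := exists_nnnorm_le_of_mem_multipliers h₁ h₂ hn hα hβ hg
    refine ⟨hg.1, K, ?_⟩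
    rintro _ ⟨z, hz, rfl⟩
    exact div_le_of_le_mul₀ zero_le zero_le (hK z hz)
  · rintro ⟨hg, K, hK⟩
    refine mem_multipliers_of_transfer h₁ h₂ hn hα hβ hA hg (K := K) fun z hz => ?_
    have := hK (mem_image_of_mem _ hz)
    exact (div_le_iff₀ (gammaFun_pos h₁ h₂ (one_le_invDist hz))).1 this

/-- A holomorphic function that tends to zero at the boundary vanishes. -/
theorem eq_zero_of_nnnorm_le (hn : 1 ≤ n) {g : EuclideanSpace ℂ (Fin n) → ℂ} (hg : g ∈ holo n)
    {φ : ℝ≥0 → ℝ≥0} (hφ : Tendsto φ atTop (𝓝 0))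
    (h : ∀ z ∈ unitBall n, ‖g z‖₊ ≤ φ (invDist z)) {z : EuclideanSpace ℂ (Fin n)}
    (hz : z ∈ unitBall n) : g z = 0 := by
  have : Nontrivial (EuclideanSpace ℂ (Fin n)) := by
    have : Nonempty (Fin n) := ⟨⟨0, hn⟩⟩
    infer_instance
  have hle : ∀ᶠ t in atTop, ‖g z‖₊ ≤ φ t := by
    filter_upwards [eventually_gt_atTop (invDist z)] with t ht
    have ht1 : 1 < t := (one_le_invDist hz).trans_lt ht
    have ht0 : (0 : ℝ) < t := by exact_mod_cast one_pos.trans ht1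
    -- On the sphere of this radius 1/(1-|w|) is exactly t, so the maximum principle gives |g(z)| ≤
    -- φ(t) for every large t.
    set r : ℝ := 1 - (t : ℝ)⁻¹ with hr
    have hr1 : r < 1 := by rw [hr]; linarith [inv_pos.2 ht0]
    have hzr : ‖z‖ < r := by
      have h1 : (invDist z : ℝ) < t := by exact_mod_cast ht
      rw [coe_invDist hz] at h1
      have h2 := inv_strictAnti₀ (inv_pos.2 (one_sub_norm_pos hz)) h1
      rw [inv_inv] at h2
      rw [hr]; linarith
    have hr0 : r ≠ 0 := ((norm_nonneg z).trans_lt hzr).ne'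
    have hsub : Metric.closedBall (0 : EuclideanSpace ℂ (Fin n)) r ⊆ unitBall n :=
      Metric.closedBall_subset_ball hr1
    have hd : DiffContOnCl ℂ g (Metric.ball 0 r) :=
      DifferentiableOn.diffContOnCl_ball hg hsub
    refine Complex.norm_le_of_forall_mem_frontier_norm_le Metric.isBounded_ball hd
      (C := φ t) (fun w hw => ?_) (subset_closure (mem_ball_zero_iff.2 hzr))
    rw [frontier_ball _ hr0, mem_sphere_zero_iff_norm] at hw
    have hwB : w ∈ unitBall n := mem_ball_zero_iff.2 (hw ▸ hr1)
    have h3 : invDist w = t := by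
      ext
      rw [coe_invDist hwB, hw, hr, sub_sub_cancel, inv_inv]
    have h4 := h w hwB
    rw [h3] at h4
    exact_mod_cast h4
  have := ge_of_tendsto hφ hle
  simpa using this

theorem mem_multipliers_of_eq_zero (h₂ : IsGrowth Φ₂) {g : EuclideanSpace ℂ (Fin n) → ℂ}
    (hg : ∀ z ∈ unitBall n, g z = 0) : g ∈ multipliers n α β Φ₁ Φ₂ := by
  have hae : ∀ᵐ z ∂(nuMeasure n β), z ∈ unitBall n :=
    Measure.ae_smul_measure (ae_mem_unitBall n β) _
  have hint : ∀ (f : EuclideanSpace ℂ (Fin n) → ℂ) (l : ℝ≥0),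
      ∫⁻ z, (Φ₂ (‖f z * g z‖₊ / l) : ℝ≥0∞) ∂(nuMeasure n β) = 0 := by
    intro f l
    rw [← lintegral_zero (μ := nuMeasure n β)]
    refine lintegral_congr_ae ?_
    filter_upwards [hae] with z hz
    simp [hg z hz, h₂.map_zero]
  have hholo : g ∈ holo n := (differentiableOn_const (0 : ℂ)).congr hg
  refine ⟨hholo, 1, one_pos, fun f hf => ⟨⟨DifferentiableOn.mul hf.1 hholo, ?_⟩, ?_⟩⟩
  · have := hint f 1
    simp only [div_one] at this
    rw [this]
    exact ENNReal.zero_lt_top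
  · refine le_trans (le_of_forall_gt fun x hx => ?_) zero_le
    obtain ⟨l, hl0, hlx⟩ := ENNReal.lt_iff_exists_nnreal_btwn.1 hx
    exact (luxNorm_le (by exact_mod_cast hl0) ((hint f l).trans_le zero_le_one)).trans_lt hlx

end Multipliers

end BergmanOrlicz

end


/-! ### The three regimes of γ -/

theorem theorem5 (n : ℕ) (hn : 1 ≤ n) (α β : ℝ) (hα : -1 < α) (hβ : -1 < β)
    (Φ₁ Φ₂ : ℝ≥0 → ℝ≥0)
    (h₁ : Φ₁ ∈ BergmanOrlicz.classL ∪ BergmanOrlicz.classU)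
    (h₂ : Φ₂ ∈ BergmanOrlicz.classL ∪ BergmanOrlicz.classU)
    (hmono : MonotoneOn (fun t => Φ₂ t / Φ₁ t) (Ioi 0)) :
    (Φ₂ ∈ BergmanOrlicz.classLTilde ∪ BergmanOrlicz.classUTilde →
      MonotoneOn (BergmanOrlicz.gammaFun n α β Φ₁ Φ₂) (Ici 1) →
        BergmanOrlicz.multipliers n α β Φ₁ Φ₂ =
          BergmanOrlicz.weightedHInf n
            (fun s => BergmanOrlicz.gammaFun n α β Φ₁ Φ₂ (1 / s))) ∧
    ((∃ c : ℝ≥0, 0 < c ∧ ∀ t : ℝ≥0, 1 ≤ t →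
        c ≤ BergmanOrlicz.gammaFun n α β Φ₁ Φ₂ t ∧
          BergmanOrlicz.gammaFun n α β Φ₁ Φ₂ t ≤ c⁻¹) →
      BergmanOrlicz.multipliers n α β Φ₁ Φ₂ = BergmanOrlicz.hInf n) ∧
    (AntitoneOn (BergmanOrlicz.gammaFun n α β Φ₁ Φ₂) (Ici 1) →
      Tendsto (BergmanOrlicz.gammaFun n α β Φ₁ Φ₂) atTop (𝓝 0) →
        BergmanOrlicz.multipliers n α β Φ₁ Φ₂ =
          {g | ∀ z ∈ BergmanOrlicz.unitBall n, g z = 0}) := by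
  open BergmanOrlicz in
  obtain ⟨p₁, q₁, C₁, b₁⟩ := exists_powerBounds h₁
  obtain ⟨p₂, q₂, C₂, b₂⟩ := exists_powerBounds h₂
  have hs : 0 ≤ (n : ℝ) + 1 + β := by linarith [(n.cast_nonneg : (0 : ℝ) ≤ n)]
  refine ⟨fun ht _ => ?_, fun ⟨c, hc, hγ⟩ => ?_, fun _ hlim => ?_⟩
  -- For t ≥ 1 the value V is at least Φ₂⁻¹(1), which may be below 1; this c is the lower bound that
  -- the transfer lemmas need.
  · set c := min 1 (growthInv Φ₂ 1) with hcdef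
    have hc : 0 < c := lt_min one_pos (b₂.growthInv_pos one_pos)
    have htrans : ∃ A : ℝ≥0, ∀ u v V : ℝ≥0, c ≤ V → u ≤ v →
        Φ₂ (u * (V / v)) * Φ₁ v ≤ A * Φ₁ u * Φ₂ V := by
      rcases ht with ht | ht
      · exact exists_transfer_of_classLTilde b₁ ht hmono hc (min_le_left _ _)
      · exact exists_transfer_of_classUTilde b₁ ht hmono hc (min_le_left _ _)
    obtain ⟨A, hA⟩ := htrans
    refine multipliers_eq_weightedHInf_of_transfer b₁ b₂ hn hα hβ (A := A) fun t u ht1 hu => ?_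
    have hV : c ≤ growthInv Φ₂ (t ^ ((n : ℝ) + 1 + β)) := by
      refine (min_le_right _ _).trans (csInf_le_csInf (OrderBot.bddBelow _) ?_ fun s hs' => ?_)
      · exact ⟨_, (b₂.growth.apply_growthInv (t ^ ((n : ℝ) + 1 + β))).ge⟩
      · exact (NNReal.one_le_rpow ht1 hs).trans hs'
    have := hA u _ _ hV hu
    rwa [b₁.growth.apply_growthInv, b₂.growth.apply_growthInv] at this
  -- The two bounds on γ = V/v say that both V/v and v/V are at most c⁻¹.
  · obtain ⟨A, hA⟩ := exists_transfer_of_bounded b₁ b₂ hmono c⁻¹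
    have hA' : ∀ t u : ℝ≥0, 1 ≤ t → u ≤ growthInv Φ₁ (t ^ ((n : ℝ) + 1 + α)) →
        Φ₂ (u * gammaFun n α β Φ₁ Φ₂ t) * t ^ ((n : ℝ) + 1 + α) ≤
          A * Φ₁ u * t ^ ((n : ℝ) + 1 + β) := by
      intro t u ht1 hu
      obtain ⟨h3, h4⟩ := hγ t ht1
      have hV := b₂.growthInv_pos (NNReal.rpow_pos (one_pos.trans_le ht1) (p := (n : ℝ) + 1 + β))
      have h5 := inv_anti₀ hc h3
      rw [gammaFun, inv_div] at h5
      have := hA u _ _ hV hu h4 h5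
      rwa [b₁.growth.apply_growthInv, b₂.growth.apply_growthInv] at this
    ext g
    constructor
    · intro hg
      obtain ⟨K, hK⟩ := exists_nnnorm_le_of_mem_multipliers b₁ b₂ hn hα hβ hg
      refine ⟨hg.1, K * c⁻¹, ?_⟩
      rintro _ ⟨z, hz, rfl⟩
      exact (hK z hz).trans (by gcongr; exact (hγ _ (one_le_invDist hz)).2)
    · rintro ⟨hg, K, hK⟩
      refine mem_multipliers_of_transfer b₁ b₂ hn hα hβ hA' hg (K := K * c⁻¹) fun z hz => ?_
      calc ‖g z‖₊ ≤ K := hK (mem_image_of_mem _ hz)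
        _ = K * c⁻¹ * c := by rw [inv_mul_cancel_right₀ hc.ne']
        _ ≤ _ := by gcongr; exact (hγ _ (one_le_invDist hz)).1
  · ext g
    constructor
    · intro hg z hz
      obtain ⟨K, hK⟩ := exists_nnnorm_le_of_mem_multipliers b₁ b₂ hn hα hβ hg
      refine eq_zero_of_nnnorm_le hn hg.1 (φ := fun t => K * gammaFun n α β Φ₁ Φ₂ t) ?_ hK hz
      simpa using hlim.const_mul K
    · exact fun hg => mem_multipliers_of_eq_zero b₂.growth hg
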